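/- Let $(\mathcal M,\mathfrak g)$ be a smooth finite-dimensional Riemannian manifold (Hausdorff, second countable, without boundary) that is geodesically complete, so that $\mathrm{Exp}_x$ is defined on all of $T_x\mathcal M$. For $v\in T_x\mathcal M$ and $y=\mathrm{Exp}_x(v)$, let $\Gamma_x^y:T_x\mathcal M\to T_y\mathcal M$ be the Levi-Civita parallel transport along the geodesic $t\mapsto \mathrm{Exp}_x(tv)$, $0\le t\le 1$, and $\Gamma_y^x$ its inverse (if any two points of $\mathcal M$ are joined by a unique geodesic, these depend only on $x,y$, and $v=\mathrm{Exp}_x^{-1}(y)$). Let $n\ge 1$, $L>0$, and let $f_1,\dots,f_n:\mathcal M\to\mathbb R$ be $L$-g-smooth: each $f_i$ is differentiable and its Riemannian gradient satisfies $\|\nabla f_i(x)-\Gamma_y^x\nabla f_i(y)\|\le L\|v\|$ for all $x\in\mathcal M$, $v\in T_x\mathcal M$, $y=\mathrm{Exp}_x(v)$. Put $f=\frac1n\sum_{i=1}^n f_i$ and let $f^*\in\mathbb R$ satisfy $f(x)\ge f^*$ for all $x\in\mathcal M$. Let $\omega\ge 0$ and let $\mathcal Q_1,\dots,\mathcal Q_n$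 be unbiased compressors with conic variance $\omega$, that is, random mappings $T_x\mathcal M\to T_x\mathcal M$ (for every $x\in\mathcal M$) with $\mathbb E[\mathcal Q_i(y)]=y$ and $\mathbb E\|\mathcal Q_i(y)-y\|^2\le\omega\|y\|^2$ for all $x\in\mathcal M$, $y\in T_x\mathcal M$. Let $p\in(0,1]$ and $$0<\eta\le\frac{1}{L\left(1+\sqrt{\frac{1-p}{p}\,\frac{\omega}{n}}\right)}.$$ Consider the Riemannian MARINA iteration: start from $x^0\in\mathcal M$ and $g_1^0,\dots,g_n^0\in T_{x^0}\mathcal M$ with $\frac1n\sum_i g_i^0=\nabla f(x^0)$ (for instance $g_i^0=\nabla f_i(x^0)$); for $k=0,1,\dots$ put $g^k=\frac1n\sum_{i=1}^n g_i^k$, $x^{k+1}=\mathrm{Exp}_{x^k}(-\eta g^k)$ and, for all $i$, $$g_i^{k+1}=\begin{cases}\nabla f_i(x^{k+1}) & \text{if } c^k=1,\\ \Gamma_{x^k}^{x^{k+1}}g_i^k+\mathcal Q_i^k\left(\nabla f_i(x^{k+1})-\Gamma_{x^k}^{x^{k+1}}\nabla f_i(x^k)\right) & \text{if } c^k=0,\end{cases}$$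 where $\Gamma_{x^k}^{x^{k+1}}$ is the transport along $t\mapsto\mathrm{Exp}_{x^k}(-t\eta g^k)$, the coin $c^k$, common to all workers, is $1$ with probability $p$ and $0$ with probability $1-p$, $\mathcal Q_i^k$ is a fresh sample of $\mathcal Q_i$, and all the $c^k$ and $\mathcal Q_i^k$ are independent. Then for every $K\ge 1$, if $\widehat x^K$ is chosen uniformly at random from $x^0,\dots,x^{K-1}$ (independently of the run), $$\mathbb E\left[\|\nabla f(\widehat x^K)\|^2\right]\le\frac{2\,(f(x^0)-f^*)}{\eta K}.$$ -/

import Mathlib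

open Bundle Manifold MeasureTheory ProbabilityTheory
open scoped ContDiff

namespace RMarina

noncomputable section

variable {E : Type*} [NormedAddCommGroup E] [NormedSpace ℝ E]
  {M : Type*} [TopologicalSpace M] [ChartedSpace E M]

/-! ### Levi-Civita parallel transport, geodesics and the exponential map -/

/-- The velocity `γ'(t)`, a tangent vector at `γ t`. -/
def velocity (γ : ℝ → M) (t : ℝ) : TangentSpace 𝓘(ℝ, E) (γ t) :=
  mfderiv 𝓘(ℝ, ℝ) 𝓘(ℝ, E) γ t (1 : ℝ)

/-- The coordinates, in the chart around `x₀`, of a vector field `V` along the curve `γ`. -/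
def coordField (x₀ : M) (γ : ℝ → M) (V : ∀ t, TangentSpace 𝓘(ℝ, E) (γ t)) (t : ℝ) : E :=
  mfderiv 𝓘(ℝ, E) 𝓘(ℝ, E) (extChartAt 𝓘(ℝ, E) x₀) (γ t) (V t)

section Riemannian

variable [RiemannianBundle (fun x : M => TangentSpace 𝓘(ℝ, E) x)]

/-- The Riemannian metric in the chart around `x₀`: the bilinear form `G(y)(u, v)` on `E`,
for `y` in the target of the chart. -/
def coordMetric (x₀ : M) (y u v : E) : ℝ :=
  inner ℝ
    (mfderiv 𝓘(ℝ, E) 𝓘(ℝ, E) (extChartAt 𝓘(ℝ, E) x₀).symm y u :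
      TangentSpace 𝓘(ℝ, E) ((extChartAt 𝓘(ℝ, E) x₀).symm y))
    (mfderiv 𝓘(ℝ, E) 𝓘(ℝ, E) (extChartAt 𝓘(ℝ, E) x₀).symm y v)

/-- Christoffel symbols of the first kind of the Levi-Civita connection in the chart around `x₀`,
`Γ(u, v; z) = (D_u G(v, z) + D_v G(u, z) - D_z G(u, v)) / 2`. -/
def christoffel (x₀ : M) (y u v z : E) : ℝ :=
  (fderiv ℝ (fun y' => coordMetric x₀ y' v z) y u
    + fderiv ℝ (fun y' => coordMetric x₀ y' u z) y v
    - fderiv ℝ (fun y' => coordMetric x₀ y' u v) y z) / 2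

/-- The vector field `V` along the curve `γ` is parallel for the Levi-Civita connection.
In every chart, with `c` the coordinate curve and `V̂` the coordinates of `V`, this is the equation
`V̂' + Γ(c', V̂) = 0`, here paired through the metric with an arbitrary vector `z`. -/
def IsParallel (γ : ℝ → M) (V : ∀ t, TangentSpace 𝓘(ℝ, E) (γ t)) : Prop :=
  ∀ (x₀ : M) (t : ℝ), γ t ∈ (chartAt E x₀).source →
    DifferentiableAt ℝ (coordField x₀ γ V) t ∧
    ∀ z : E,
      coordMetric x₀ (extChartAt 𝓘(ℝ, E) x₀ (γ t)) (deriv (coordField x₀ γ V) t) z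
        + christoffel x₀ (extChartAt 𝓘(ℝ, E) x₀ (γ t))
            (coordField x₀ γ (velocity γ) t) (coordField x₀ γ V t) z = 0

/-- Parallel transport `T_{γ(a)} M → T_{γ(b)} M` along the curve `γ`. -/
def parallelTransport (γ : ℝ → M) (a b : ℝ) (w : TangentSpace 𝓘(ℝ, E) (γ a)) :
    TangentSpace 𝓘(ℝ, E) (γ b) :=
  open Classical in
  if h : ∃ V : ∀ t, TangentSpace 𝓘(ℝ, E) (γ t), IsParallel γ V ∧ V a = w
  then h.choose b else 0

/-- Geodesics: smooth curves with parallel velocity. -/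
structure IsGeodesic (γ : ℝ → M) : Prop where
  contMDiff : ContMDiff 𝓘(ℝ, ℝ) 𝓘(ℝ, E) ∞ γ
  parallel_velocity : IsParallel γ (velocity (E := E) γ)

/-- `γ` is a geodesic with `γ(0) = x` and `γ'(0) = v`. -/
def IsGeodesicFrom (x : M) (v : TangentSpace 𝓘(ℝ, E) x) (γ : ℝ → M) : Prop :=
  IsGeodesic (E := E) γ ∧ (⟨γ 0, velocity γ 0⟩ : TangentBundle 𝓘(ℝ, E) M) = ⟨x, v⟩

variable (E M) in
/-- Geodesic completeness: the exponential map is defined on the whole tangent bundle. -/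
def GeodesicallyComplete : Prop :=
  ∀ (x : M) (v : TangentSpace 𝓘(ℝ, E) x), ∃ γ : ℝ → M, IsGeodesicFrom x v γ

/-- The geodesic issued from `x` with initial velocity `v`. -/
def geod (x : M) (v : TangentSpace 𝓘(ℝ, E) x) : ℝ → M :=
  open Classical in
  if h : ∃ γ : ℝ → M, IsGeodesicFrom x v γ then h.choose else fun _ => x

theorem geod_zero (x : M) (v : TangentSpace 𝓘(ℝ, E) x) : geod x v 0 = x := by
  unfold geod
  split_ifs with h
  · exact congrArg TotalSpace.proj h.choose_spec.2
  · rfl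

/-- The exponential map `Exp_x(v)`. -/
def riemExp (x : M) (v : TangentSpace 𝓘(ℝ, E) x) : M := geod x v 1

/-- Parallel transport `T_x M → T_{Exp_x(v)} M` along the geodesic `t ↦ Exp_x(t v)`, `0 ≤ t ≤ 1`. -/
def expTransport (x : M) (v w : TangentSpace 𝓘(ℝ, E) x) : TangentSpace 𝓘(ℝ, E) (riemExp x v) :=
  parallelTransport (geod x v) 0 1 ((geod_zero x v).symm ▸ w)

/-! ### Gradients and geodesic smoothness -/

/-- The Riemannian gradient: the vector representing the differential `df_x`. -/
def riemGrad [FiniteDimensional ℝ E] (f : M → ℝ) (x : M) : TangentSpace 𝓘(ℝ, E) x :=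
  haveI : FiniteDimensional ℝ (TangentSpace 𝓘(ℝ, E) x) := inferInstanceAs (FiniteDimensional ℝ E)
  haveI : CompleteSpace (TangentSpace 𝓘(ℝ, E) x) := FiniteDimensional.complete ℝ _
  (InnerProductSpace.toDual ℝ (TangentSpace 𝓘(ℝ, E) x)).symm (mfderiv 𝓘(ℝ, E) 𝓘(ℝ, ℝ) f x)

variable (E) in
/-- `f` is geodesically `L`-smooth: it is differentiable and its gradient is `L`-Lipschitz along
geodesics, `‖∇f(x) - Γ_y^x ∇f(y)‖ ≤ L ‖v‖` whenever `y = Exp_x(v)`, where `Γ_y^x` is the parallel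
transport along the geodesic from `x` to `y` with initial velocity `v`. -/
structure IsGSmooth [FiniteDimensional ℝ E] (L : ℝ) (f : M → ℝ) : Prop where
  mdifferentiable : MDifferentiable 𝓘(ℝ, E) 𝓘(ℝ, ℝ) f
  lipschitz : ∀ γ : ℝ → M, IsGeodesic (E := E) γ →
    ‖riemGrad (E := E) f (γ 0) - parallelTransport γ 1 0 (riemGrad f (γ 1))‖
      ≤ L * ‖velocity (E := E) γ 0‖

/-! ### Compressors -/

/-- A stochastic mapping of the tangent spaces, `Q s x : T_x M → T_x M` with `s` drawn from `ν`,
is an unbiased compressor with conic variance `ωQ`. -/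
structure IsUnbiasedCompressor {S : Type*} [MeasurableSpace S] (ν : Measure S)
    (Q : S → ∀ x : M, TangentSpace 𝓘(ℝ, E) x → TangentSpace 𝓘(ℝ, E) x) (ωQ : ℝ) : Prop where
  nonneg : 0 ≤ ωQ
  integrable : ∀ (x : M) (v : TangentSpace 𝓘(ℝ, E) x), Integrable (fun s => Q s x v) ν
  unbiased : ∀ (x : M) (v : TangentSpace 𝓘(ℝ, E) x), ∫ s, Q s x v ∂ν = v
  integrable_sq : ∀ (x : M) (v : TangentSpace 𝓘(ℝ, E) x),
    Integrable (fun s => ‖Q s x v - v‖ ^ 2) ν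
  variance_le : ∀ (x : M) (v : TangentSpace 𝓘(ℝ, E) x),
    ∫ s, ‖Q s x v - v‖ ^ 2 ∂ν ≤ ωQ * ‖v‖ ^ 2

/-! ### The algorithm -/

/-- The objective `f = (1/n) ∑ f_i`. -/
def objective {n : ℕ} (f : Fin n → M → ℝ) (x : M) : ℝ := (1 / (n : ℝ)) * ∑ i, f i x

variable (E M) in
/-- A state of the algorithm: the point `x^k` and the workers' estimators `g_i^k ∈ T_{x^k} M`. -/
structure State (n : ℕ) where
  pt : M
  est : Fin n → TangentSpace 𝓘(ℝ, E) pt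

/-- The aggregated estimator `g^k = (1/n) ∑ g_i^k`. -/
def State.avg {n : ℕ} (σ : State E M n) : TangentSpace 𝓘(ℝ, E) σ.pt :=
  (1 / (n : ℝ)) • ∑ i, σ.est i

/-- One iteration. The coin `c` is common to all workers: if it is `true`, every worker sends its
full gradient, otherwise worker `i` sends a compressed difference, with the randomness `s i`. -/
def marinaStep [FiniteDimensional ℝ E] {S : Type*} {n : ℕ} (f : Fin n → M → ℝ)
    (Q : Fin n → S → ∀ x : M, TangentSpace 𝓘(ℝ, E) x → TangentSpace 𝓘(ℝ, E) x) (η : ℝ)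
    (σ : State E M n) (c : Bool) (s : Fin n → S) : State E M n where
  pt := riemExp σ.pt (-(η • σ.avg))
  est := fun i =>
    if c then riemGrad (f i) (riemExp σ.pt (-(η • σ.avg)))
    else expTransport σ.pt (-(η • σ.avg)) (σ.est i)
      + Q i (s i) (riemExp σ.pt (-(η • σ.avg)))
          (riemGrad (f i) (riemExp σ.pt (-(η • σ.avg)))
            - expTransport σ.pt (-(η • σ.avg)) (riemGrad (f i) σ.pt))

/-- The state after `k` iterations, as a function of the random inputs `r 0, r 1, …` (a coin and
one compressor sample per worker at each iteration). -/
def marina [FiniteDimensional ℝ E] {S : Type*} {n : ℕ} (f : Fin n → M → ℝ)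
    (Q : Fin n → S → ∀ x : M, TangentSpace 𝓘(ℝ, E) x → TangentSpace 𝓘(ℝ, E) x) (η : ℝ)
    (σ₀ : State E M n) (r : ℕ → Bool × (Fin n → S)) : ℕ → State E M n
  | 0 => σ₀
  | k + 1 => marinaStep f Q η (marina f Q η σ₀ r k) (r k).1 (r k).2

end Riemannian

/-- The law of a coin that is `true` with probability `p`. -/
def coinLaw (p : ℝ) : Measure Bool :=
  ENNReal.ofReal p • Measure.dirac true + ENNReal.ofReal (1 - p) • Measure.dirac false

end

end RMarina

/-! The proof is a Lyapunov argument for Φ = f(x) - f* + η/(2p) ‖g - ∇f(x)‖². Integrating geodesic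
smoothness along x⁺ = Exp_x(-ηg) gives f(x⁺) ≤ f(x) - η/2 (‖∇f‖² + ‖g‖² - ‖g - ∇f‖²) + Lη²/2 ‖g‖²
(`objective_step_le`). The error g - ∇f(x) is reset to zero when the coin is `true`. Otherwise it
becomes its own parallel transport plus an average of independent centered compression errors.
Transport is isometric and each compressed vector has norm at most Lη‖g‖, so the squared error grows
in expectation by at most (ω/n)(Lη)²‖g‖² (`lintegral_error_compressed_le`). The weight η/(2p) makes
the error terms cancel, and the step-size bound makes the coefficient of ‖g‖² nonpositive. Hence Φ
decreases in expectation by at least η/2 ‖∇f(x)‖² (`lintegral_potential_step_le`). Since the initial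
error is zero, telescoping and averaging over the uniform index give the bound.

Two foundations carry this argument. The geometric one is that parallel transport along a smooth
curve is a linear isometry (`parallelTransportₗᵢ`). In a chart the parallel equation is a linear
ODE, hence locally solvable; the transformation law of the Christoffel symbols makes it chart
independent; metric compatibility makes inner products of parallel fields constant, which yields
both isometry and uniqueness; a clopen argument extends solutions to all times. The probabilistic
one is measurability. Only the pairs (x^k, g^k) are assumed measurable, so the potential must be a
Borel function on the tangent bundle, which is checked chart by chart. -/

namespace RMarina

noncomputable section

/-! ### Local solvability of linear ODEs. -/

section LinearODE

open Set Metric Topology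
open scoped NNReal

variable {E : Type*} [NormedAddCommGroup E] [NormedSpace ℝ E]

/-- A linear differential equation with continuous coefficients near `t₀` is solvable, for all
initial conditions, on a fixed neighbourhood of `t₀`. -/
theorem exists_forall_hasDerivAt_linear [CompleteSpace E] {A : ℝ → E →L[ℝ] E} {t₀ : ℝ}
    (hA : ∀ᶠ t in 𝓝 t₀, ContinuousAt A t) :
    ∃ ε > 0, ∀ t₁ ∈ Ioo (t₀ - ε) (t₀ + ε), ∀ w : E, ∃ α : ℝ → E, α t₁ = w ∧
      ∀ t ∈ Ioo (t₀ - ε) (t₀ + ε), HasDerivAt α (A t (α t)) t := by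
  have hbd : ∀ᶠ t in 𝓝 t₀, ‖A t‖ < ‖A t₀‖ + 1 :=
    (hA.self_of_nhds.norm).eventually (gt_mem_nhds (by linarith))
  obtain ⟨δ, hδ, hball⟩ := Metric.eventually_nhds_iff.1 (hA.and hbd)
  set C : ℝ≥0 := ‖A t₀‖₊ + 1 with hC
  have hCr : (C : ℝ) = ‖A t₀‖ + 1 := by simp [hC]
  have hCpos : (0 : ℝ) < C := by rw [hCr]; positivity
  -- The half of `δ` keeps the closed interval inside the ball where `A` is continuous and bounded
  -- by `C`. The other bound gives 2Cε ≤ 1/2, which does not involve `w`.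
  refine ⟨min (δ / 2) (1 / (4 * C)), by positivity, fun t₁ ht₁ w => ?_⟩
  set ε := min (δ / 2) (1 / (4 * (C : ℝ))) with hε
  have hεδ : ε ≤ δ / 2 := min_le_left _ _
  have hεC : ε * (4 * C) ≤ 1 := by
    have : ε ≤ 1 / (4 * C) := min_le_right _ _
    rwa [le_div_iff₀ (by positivity)] at this
  have hmem : ∀ t ∈ Icc (t₀ - ε) (t₀ + ε), ContinuousAt A t ∧ ‖A t‖ ≤ C := by
    intro t ht
    have := hball (y := t) (by
      rw [Real.dist_eq, abs_lt]
      constructor <;> linarith [ht.1, ht.2])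
    exact ⟨this.1, by rw [hCr]; exact this.2.le⟩
  -- The radius grows linearly with ‖w‖, as does the speed bound on that ball: by linearity both
  -- scale together, so one ε serves all initial values.
  have hPL : IsPicardLindelof (fun t v => A t v) (tmin := t₀ - ε) (tmax := t₀ + ε)
      ⟨t₁, Ioo_subset_Icc_self ht₁⟩ w (‖w‖₊ + 1) 0 (C * (2 * ‖w‖₊ + 1)) C := by
    refine ⟨fun t ht => ?_, fun x _ t ht => ?_, fun t ht x hx => ?_, ?_⟩
    · refine ((A t).lipschitz.weaken ?_).lipschitzOnWith
      exact_mod_cast (hmem t ht).2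
    · exact ((hmem t ht).1.clm_apply continuousAt_const).continuousWithinAt
    · have h1 : ‖x‖ ≤ 2 * ‖w‖ + 1 := by
        have h2 : ‖x - w‖ ≤ ‖w‖ + 1 := by simpa [dist_eq_norm] using hx
        have h3 : ‖x‖ ≤ ‖x - w‖ + ‖w‖ := by simpa using norm_add_le (x - w) w
        linarith
      calc ‖A t x‖ ≤ ‖A t‖ * ‖x‖ := (A t).le_opNorm x
        _ ≤ C * (2 * ‖w‖ + 1) := by gcongr; exact (hmem t ht).2
        _ = _ := by simp
    · have h1 : max (t₀ + ε - t₁) (t₁ - (t₀ - ε)) ≤ 2 * ε :=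
        max_le (by linarith [ht₁.1]) (by linarith [ht₁.2])
      have h2 : (0 : ℝ) ≤ ‖w‖ := norm_nonneg w
      have h3 : (C : ℝ) * (2 * ‖w‖ + 1) * (2 * ε) ≤ ‖w‖ + 1 := by nlinarith
      push_cast
      simp only [sub_zero]
      refine le_trans ?_ h3
      gcongr
  obtain ⟨α, h0, hα⟩ := hPL.exists_eq_forall_mem_Icc_hasDerivWithinAt₀
  exact ⟨α, h0, fun t ht => (hα t (Ioo_subset_Icc_self ht)).hasDerivAt (Icc_mem_nhds ht.1 ht.2)⟩

end LinearODE

/-! ### Christoffel symbols of a field of bilinear forms on a vector space. -/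

section BilinearForms

open Topology Filter

variable {E : Type*} [NormedAddCommGroup E] [NormedSpace ℝ E]

/-- The Christoffel symbols of the first kind of a field `G` of bilinear forms. -/
def christoffelForm (G : E → E →L[ℝ] E →L[ℝ] ℝ) (y u : E) : E →L[ℝ] E →L[ℝ] ℝ :=
  (1 / 2 : ℝ) • (fderiv ℝ G y u + (fderiv ℝ G y).flip u - ((fderiv ℝ G y).flip u).flip)

set_option synthInstance.maxHeartbeats 200000 in
theorem christoffelForm_apply (G : E → E →L[ℝ] E →L[ℝ] ℝ) (y u v z : E) :
    christoffelForm G y u v z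
      = (fderiv ℝ G y u v z + fderiv ℝ G y v u z - fderiv ℝ G y z u v) / 2 := by
  simp [christoffelForm]
  ring

set_option synthInstance.maxHeartbeats 200000 in
theorem christoffelForm_smul_smul (G : E → E →L[ℝ] E →L[ℝ] ℝ) (y u v z : E) (a b : ℝ) :
    christoffelForm G y (a • u) (b • v) z = a * (b * christoffelForm G y u v z) := by
  rw [christoffelForm_apply, christoffelForm_apply]
  simp only [map_smul, smul_apply, smul_eq_mul]
  ring

/-- Compatibility of the Christoffel symbols with a field of symmetric bilinear forms. -/
theorem christoffelForm_add_swap {G : E → E →L[ℝ] E →L[ℝ] ℝ} {y : E}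
    (hsymm : ∀ u v w, fderiv ℝ G y u v w = fderiv ℝ G y u w v) (u v w : E) :
    christoffelForm G y u v w + christoffelForm G y u w v = fderiv ℝ G y u v w := by
  rw [christoffelForm_apply, christoffelForm_apply, hsymm u w v, hsymm w u v, hsymm v u w]
  ring

-- Differentiation commutes with evaluation at fixed vectors, and the two scalar components coincide
-- near `y`.
set_option synthInstance.maxHeartbeats 200000 in
theorem fderiv_symm_of_eventually {G : E → E →L[ℝ] E →L[ℝ] ℝ} {y : E}
    (hG : DifferentiableAt ℝ G y) (hsymm : ∀ᶠ y' in 𝓝 y, ∀ v w, G y' v w = G y' w v) (u v w : E) :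
    fderiv ℝ G y u v w = fderiv ℝ G y u w v := by
  have h1 : ∀ v w : E, fderiv ℝ G y u v w = fderiv ℝ (fun y' => G y' v w) y u := by
    intro v w
    have h := (hG.hasFDerivAt.clm_apply (hasFDerivAt_const v y)).clm_apply (hasFDerivAt_const w y)
    rw [h.fderiv]
    simp
  rw [h1, h1]
  have : (fun y' => G y' v w) =ᶠ[𝓝 y] fun y' => G y' w v := hsymm.mono fun y' h => h v w
  rw [this.fderiv_eq]

set_option synthInstance.maxHeartbeats 200000 in
/-- The transformation law of the Christoffel symbols under a change of coordinates `φ`. -/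
theorem christoffelForm_pullback {G H : E → E →L[ℝ] E →L[ℝ] ℝ} {φ : E → E} {y : E}
    (hφ : ContDiffAt ℝ 2 φ y) (hG : DifferentiableAt ℝ G y) (hH : DifferentiableAt ℝ H (φ y))
    (hsymm : ∀ v w, H (φ y) v w = H (φ y) w v)
    (hGH : ∀ᶠ y' in 𝓝 y, ∀ u v, G y' u v = H (φ y') (fderiv ℝ φ y' u) (fderiv ℝ φ y' v))
    (u v z : E) :
    christoffelForm G y u v z
      = christoffelForm H (φ y) (fderiv ℝ φ y u) (fderiv ℝ φ y v) (fderiv ℝ φ y z)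
        + H (φ y) (fderiv ℝ (fderiv ℝ φ) y u v) (fderiv ℝ φ y z) := by
  have hφ1 : DifferentiableAt ℝ φ y := hφ.differentiableAt (by norm_num)
  have hφ2 : DifferentiableAt ℝ (fderiv ℝ φ) y :=
    (hφ.fderiv_right (m := 1) (by norm_num)).differentiableAt (by norm_num)
  have hsd : ∀ a b, fderiv ℝ (fderiv ℝ φ) y a b = fderiv ℝ (fderiv ℝ φ) y b a := by
    intro a b
    exact (hφ.isSymmSndFDerivAt (by simp)) a b
  -- The product rule applied to the pull-back identity: one term differentiates `H`, the other two
  -- differentiate the two copies of Dφ.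
  have key : ∀ a b c : E, fderiv ℝ G y a b c
      = fderiv ℝ H (φ y) (fderiv ℝ φ y a) (fderiv ℝ φ y b) (fderiv ℝ φ y c)
        + H (φ y) (fderiv ℝ (fderiv ℝ φ) y a b) (fderiv ℝ φ y c)
        + H (φ y) (fderiv ℝ φ y b) (fderiv ℝ (fderiv ℝ φ) y a c) := by
    intro a b c
    have h1 : fderiv ℝ G y a b c = fderiv ℝ (fun y' => G y' b c) y a := by
      have h := (hG.hasFDerivAt.clm_apply (hasFDerivAt_const b y)).clm_apply
        (hasFDerivAt_const c y)
      rw [h.fderiv]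
      simp
    have h2 : (fun y' => G y' b c)
        =ᶠ[𝓝 y] fun y' => H (φ y') (fderiv ℝ φ y' b) (fderiv ℝ φ y' c) :=
      hGH.mono fun y' h => h b c
    have h3 : HasFDerivAt (fun y' => H (φ y')) ((fderiv ℝ H (φ y)).comp (fderiv ℝ φ y)) y :=
      HasFDerivAt.comp (g := H) (g' := fderiv ℝ H (φ y)) y hH.hasFDerivAt hφ1.hasFDerivAt
    have h4 := (h3.clm_apply (hφ2.hasFDerivAt.clm_apply (hasFDerivAt_const b y))).clm_apply
      (hφ2.hasFDerivAt.clm_apply (hasFDerivAt_const c y))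
    rw [h1, h2.fderiv_eq, h4.fderiv]
    simp
    ring
  -- Of the six terms with D²φ, the symmetry of D²φ and of `H` cancels four; the remaining two are
  -- equal and absorb the factor 1/2.
  rw [christoffelForm_apply, christoffelForm_apply, key, key, key, hsd v u, hsd z u, hsd z v,
    hsymm (fderiv ℝ φ y v) (fderiv ℝ (fderiv ℝ φ) y u z),
    hsymm (fderiv ℝ φ y u) (fderiv ℝ (fderiv ℝ φ) y v z)]
  ring

set_option synthInstance.maxHeartbeats 200000 in
theorem hasDerivAt_bilinear_comp {G : E → E →L[ℝ] E →L[ℝ] ℝ} {c v w : ℝ → E} {c' v' w' : E} {t : ℝ}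
    (hG : DifferentiableAt ℝ G (c t)) (hc : HasDerivAt c c' t) (hv : HasDerivAt v v' t)
    (hw : HasDerivAt w w' t) :
    HasDerivAt (fun s => G (c s) (v s) (w s))
      (fderiv ℝ G (c t) c' (v t) (w t) + G (c t) v' (w t) + G (c t) (v t) w') t := by
  have h : HasDerivAt (fun s => G (c s)) (fderiv ℝ G (c t) c') t :=
    HasFDerivAt.comp_hasDerivAt (l := G) t hG.hasFDerivAt hc
  exact (h.clm_apply hv).clm_apply hw

end BilinearForms

end

end RMarina

namespace RMarina

noncomputable section

/-! ### Charts, changes of coordinates and the metric in coordinates. -/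

section Coordinates

open Topology Filter Set

variable {E : Type*} [NormedAddCommGroup E] [NormedSpace ℝ E]
  {M : Type*} [TopologicalSpace M] [ChartedSpace E M]

section Charts

theorem eventually_transition {x₀ x₁ : M} {y : E} (hy : y ∈ (extChartAt 𝓘(ℝ, E) x₀).target)
    (hx : (extChartAt 𝓘(ℝ, E) x₀).symm y ∈ (chartAt E x₁).source) :
    ∀ᶠ y' in 𝓝 y, y' ∈ (extChartAt 𝓘(ℝ, E) x₀).target ∧
      (extChartAt 𝓘(ℝ, E) x₀).symm y' ∈ (chartAt E x₁).source := by
  have h1 : ContinuousAt (extChartAt 𝓘(ℝ, E) x₀).symm y :=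
    continuousAt_extChartAt_symm'' hy
  exact ((isOpen_extChartAt_target (I := 𝓘(ℝ, E)) x₀).eventually_mem hy).and
    (h1.eventually ((chartAt E x₁).open_source.eventually_mem hx))

variable [IsManifold 𝓘(ℝ, E) ∞ M]

theorem chart_mfderiv_comp_symm {x₀ : M} {y : E} (hy : y ∈ (extChartAt 𝓘(ℝ, E) x₀).target) :
    (mfderiv 𝓘(ℝ, E) 𝓘(ℝ, E) (extChartAt 𝓘(ℝ, E) x₀) ((extChartAt 𝓘(ℝ, E) x₀).symm y)).comp
      (mfderiv 𝓘(ℝ, E) 𝓘(ℝ, E) (extChartAt 𝓘(ℝ, E) x₀).symm y)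
      = ContinuousLinearMap.id ℝ _ := by
  have : IsManifold 𝓘(ℝ, E) 1 M := IsManifold.of_le (n := ∞) (by simp)
  have h := mfderiv_extChartAt_comp_mfderivWithin_extChartAt_symm (I := 𝓘(ℝ, E)) hy
  simpa only [modelWithCornersSelf_coe, range_id, mfderivWithin_univ] using h

theorem chart_symm_mfderiv_comp {x₀ : M} {y : E} (hy : y ∈ (extChartAt 𝓘(ℝ, E) x₀).target) :
    (mfderiv 𝓘(ℝ, E) 𝓘(ℝ, E) (extChartAt 𝓘(ℝ, E) x₀).symm y).comp
      (mfderiv 𝓘(ℝ, E) 𝓘(ℝ, E) (extChartAt 𝓘(ℝ, E) x₀) ((extChartAt 𝓘(ℝ, E) x₀).symm y))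
      = ContinuousLinearMap.id ℝ _ := by
  have : IsManifold 𝓘(ℝ, E) 1 M := IsManifold.of_le (n := ∞) (by simp)
  have h := mfderivWithin_extChartAt_symm_comp_mfderiv_extChartAt (I := 𝓘(ℝ, E)) hy
  simpa only [modelWithCornersSelf_coe, range_id, mfderivWithin_univ] using h

theorem mdifferentiableAt_chart {x₀ x : M} (hx : x ∈ (chartAt E x₀).source) :
    MDifferentiableAt 𝓘(ℝ, E) 𝓘(ℝ, E) (extChartAt 𝓘(ℝ, E) x₀) x := by
  have : IsManifold 𝓘(ℝ, E) 1 M := IsManifold.of_le (n := ∞) (by simp)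
  exact mdifferentiableAt_extChartAt hx

theorem mdifferentiableAt_chart_symm {x₀ : M} {y : E}
    (hy : y ∈ (extChartAt 𝓘(ℝ, E) x₀).target) :
    MDifferentiableAt 𝓘(ℝ, E) 𝓘(ℝ, E) (extChartAt 𝓘(ℝ, E) x₀).symm y := by
  have : IsManifold 𝓘(ℝ, E) 1 M := IsManifold.of_le (n := ∞) (by simp)
  have h := mdifferentiableWithinAt_extChartAt_symm (I := 𝓘(ℝ, E)) hy
  simpa only [modelWithCornersSelf_coe, range_id, mdifferentiableWithinAt_univ] using h

/-- The change of coordinates from the chart around `x₀` to the chart around `x₁`. -/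
def transition (x₀ x₁ : M) (y : E) : E :=
  extChartAt 𝓘(ℝ, E) x₁ ((extChartAt 𝓘(ℝ, E) x₀).symm y)

theorem fderiv_transition {x₀ x₁ : M} {y : E} (hy : y ∈ (extChartAt 𝓘(ℝ, E) x₀).target)
    (hx : (extChartAt 𝓘(ℝ, E) x₀).symm y ∈ (chartAt E x₁).source) :
    fderiv ℝ (transition x₀ x₁) y
      = (mfderiv 𝓘(ℝ, E) 𝓘(ℝ, E) (extChartAt 𝓘(ℝ, E) x₁)
          ((extChartAt 𝓘(ℝ, E) x₀).symm y)).comp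
        (mfderiv 𝓘(ℝ, E) 𝓘(ℝ, E) (extChartAt 𝓘(ℝ, E) x₀).symm y) := by
  rw [← mfderiv_eq_fderiv]
  exact mfderiv_comp y (mdifferentiableAt_chart hx) (mdifferentiableAt_chart_symm hy)

theorem contDiffAt_transition {x₀ x₁ : M} {y : E} (hy : y ∈ (extChartAt 𝓘(ℝ, E) x₀).target)
    (hx : (extChartAt 𝓘(ℝ, E) x₀).symm y ∈ (chartAt E x₁).source) :
    ContDiffAt ℝ ∞ (transition x₀ x₁) y := by
  rw [← contMDiffAt_iff_contDiffAt]
  have h1 : ContMDiffAt 𝓘(ℝ, E) 𝓘(ℝ, E) ∞ (extChartAt 𝓘(ℝ, E) x₀).symm y :=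
    (contMDiffOn_extChartAt_symm x₀).contMDiffAt
      ((isOpen_extChartAt_target (I := 𝓘(ℝ, E)) x₀).mem_nhds hy)
  have h2 : ContMDiffAt 𝓘(ℝ, E) 𝓘(ℝ, E) ∞ (extChartAt 𝓘(ℝ, E) x₁)
      ((extChartAt 𝓘(ℝ, E) x₀).symm y) :=
    contMDiffOn_extChartAt.contMDiffAt ((chartAt E x₁).open_source.mem_nhds hx)
  exact h2.comp y h1

/-- The coordinates of a vector field along `γ` in two charts are related by the derivative of
the change of coordinates. -/
theorem coordField_transition {x₀ x₁ : M} {γ : ℝ → M} {t : ℝ}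
    (V : ∀ t, TangentSpace 𝓘(ℝ, E) (γ t))
    (h₀ : γ t ∈ (chartAt E x₀).source) (h₁ : γ t ∈ (chartAt E x₁).source) :
    coordField x₁ γ V t
      = fderiv ℝ (transition x₀ x₁) (extChartAt 𝓘(ℝ, E) x₀ (γ t)) (coordField x₀ γ V t) := by
  have h₀' : γ t ∈ (extChartAt 𝓘(ℝ, E) x₀).source := by rwa [extChartAt_source]
  have hy := (extChartAt 𝓘(ℝ, E) x₀).map_source h₀'
  have hinv := (extChartAt 𝓘(ℝ, E) x₀).left_inv h₀'
  unfold coordField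
  -- The type of the vector depends on its base point, so both are generalized before the point is
  -- replaced by the image of `y` under the inverse chart.
  generalize V t = v
  revert v h₀ h₁ h₀' hy hinv
  generalize γ t = x
  intro h₀ h₁ h₀' hy hinv v
  generalize extChartAt 𝓘(ℝ, E) x₀ x = y at hy hinv
  subst hinv
  rw [fderiv_transition hy h₁]
  have := congrArg (fun A => A v) (chart_symm_mfderiv_comp hy)
  exact congrArg _ this.symm

theorem coordField_velocity {x₀ : M} {γ : ℝ → M} {t : ℝ}
    (hγ : MDifferentiableAt 𝓘(ℝ, ℝ) 𝓘(ℝ, E) γ t) (h₀ : γ t ∈ (chartAt E x₀).source) :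
    coordField x₀ γ (velocity γ) t = deriv (fun s => extChartAt 𝓘(ℝ, E) x₀ (γ s)) t := by
  have h := mfderiv_comp t (mdifferentiableAt_chart h₀) hγ
  have h2 : deriv (fun s => extChartAt 𝓘(ℝ, E) x₀ (γ s)) t
      = mfderiv 𝓘(ℝ, ℝ) 𝓘(ℝ, E) ((extChartAt 𝓘(ℝ, E) x₀) ∘ γ) t (1 : ℝ) := by
    rw [mfderiv_eq_fderiv]
    rfl
  rw [h2, h]
  rfl

theorem contDiffAt_chart_comp {x₀ : M} {γ : ℝ → M} {t : ℝ}
    (hγ : ContMDiff 𝓘(ℝ, ℝ) 𝓘(ℝ, E) ∞ γ) (h₀ : γ t ∈ (chartAt E x₀).source) :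
    ContDiffAt ℝ ∞ (fun s => extChartAt 𝓘(ℝ, E) x₀ (γ s)) t := by
  rw [← contMDiffAt_iff_contDiffAt]
  have h2 : ContMDiffAt 𝓘(ℝ, E) 𝓘(ℝ, E) ∞ (extChartAt 𝓘(ℝ, E) x₀) (γ t) :=
    contMDiffOn_extChartAt.contMDiffAt ((chartAt E x₀).open_source.mem_nhds h₀)
  exact h2.comp t (hγ t)

end Charts

section Metric

variable [RiemannianBundle (fun x : M => TangentSpace 𝓘(ℝ, E) x)]

/-- The metric in the chart around `x₀`, as a field of continuous bilinear forms. -/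
def metricForm (x₀ : M) (y : E) : E →L[ℝ] E →L[ℝ] ℝ :=
  let A : E →L[ℝ] TangentSpace 𝓘(ℝ, E) ((extChartAt 𝓘(ℝ, E) x₀).symm y) :=
    mfderiv 𝓘(ℝ, E) 𝓘(ℝ, E) (extChartAt 𝓘(ℝ, E) x₀).symm y
  (innerSL ℝ).bilinearComp A A

theorem metricForm_apply (x₀ : M) (y u v : E) : metricForm x₀ y u v = coordMetric x₀ y u v := rfl

theorem coordMetric_symm (x₀ : M) (y u v : E) : coordMetric x₀ y u v = coordMetric x₀ y v u :=
  real_inner_comm _ _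

variable [IsManifold 𝓘(ℝ, E) ∞ M]

/-- The derivatives of the chart and of its inverse cancel, so reading vectors in a chart is
isometric for the coordinate metric. -/
theorem coordMetric_mfderiv {x₀ x : M} (hx : x ∈ (chartAt E x₀).source)
    (v w : TangentSpace 𝓘(ℝ, E) x) :
    coordMetric x₀ (extChartAt 𝓘(ℝ, E) x₀ x)
      (mfderiv 𝓘(ℝ, E) 𝓘(ℝ, E) (extChartAt 𝓘(ℝ, E) x₀) x v)
      (mfderiv 𝓘(ℝ, E) 𝓘(ℝ, E) (extChartAt 𝓘(ℝ, E) x₀) x w) = inner ℝ v w := by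
  have hx' : x ∈ (extChartAt 𝓘(ℝ, E) x₀).source := by rwa [extChartAt_source]
  have hy := (extChartAt 𝓘(ℝ, E) x₀).map_source hx'
  have hinv := (extChartAt 𝓘(ℝ, E) x₀).left_inv hx'
  generalize extChartAt 𝓘(ℝ, E) x₀ x = y at hy hinv
  subst hinv
  have h (a : TangentSpace 𝓘(ℝ, E) ((extChartAt 𝓘(ℝ, E) x₀).symm y)) :=
    congrArg (fun A => A a) (chart_symm_mfderiv_comp hy)
  exact congrArg₂ (fun a b => inner ℝ a b) (h v) (h w)

theorem coordMetric_coordField {x₀ : M} {γ : ℝ → M} {t : ℝ}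
    (h₀ : γ t ∈ (chartAt E x₀).source) (V W : ∀ t, TangentSpace 𝓘(ℝ, E) (γ t)) :
    coordMetric x₀ (extChartAt 𝓘(ℝ, E) x₀ (γ t)) (coordField x₀ γ V t) (coordField x₀ γ W t)
      = inner ℝ (V t) (W t) :=
  coordMetric_mfderiv h₀ _ _

theorem metricForm_transition {x₀ x₁ : M} {y : E} (hy : y ∈ (extChartAt 𝓘(ℝ, E) x₀).target)
    (hx : (extChartAt 𝓘(ℝ, E) x₀).symm y ∈ (chartAt E x₁).source) (u v : E) :
    metricForm x₀ y u v = metricForm x₁ (transition x₀ x₁ y)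
      (fderiv ℝ (transition x₀ x₁) y u) (fderiv ℝ (transition x₀ x₁) y v) := by
  rw [fderiv_transition hy hx, metricForm_apply, metricForm_apply]
  exact (coordMetric_mfderiv hx _ _).symm

/-- The derivative of the inverse chart has a left inverse, hence kills no nonzero vector. -/
theorem coordMetric_self_pos {x₀ : M} {y : E} (hy : y ∈ (extChartAt 𝓘(ℝ, E) x₀).target) {u : E}
    (hu : u ≠ 0) : 0 < coordMetric x₀ y u u := by
  refine lt_of_le_of_ne real_inner_self_nonneg fun h => hu ?_
  have h0 := inner_self_eq_zero.1 h.symm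
  have h1 := congrArg (fun A => A u) (chart_mfderiv_comp_symm hy)
  have h2 : mfderiv 𝓘(ℝ, E) 𝓘(ℝ, E) (extChartAt 𝓘(ℝ, E) x₀) ((extChartAt 𝓘(ℝ, E) x₀).symm y)
    (mfderiv 𝓘(ℝ, E) 𝓘(ℝ, E) (extChartAt 𝓘(ℝ, E) x₀).symm y u) = u := h1
  rw [h0] at h2
  rw [← h2]
  exact map_zero _

/-- Positivity gives injectivity into the dual, which has the same finite dimension. Invertibility
allows the parallel equation to be solved for the derivative of the field. -/
theorem metricForm_isInvertible [FiniteDimensional ℝ E] {x₀ : M} {y : E} (hy : y ∈ (extChartAt 𝓘(ℝ, E) x₀).target) :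
    (metricForm x₀ y).IsInvertible := by
  have hinj : Function.Injective (metricForm x₀ y) := by
    rw [injective_iff_map_eq_zero]
    intro u hu
    by_contra h
    have := coordMetric_self_pos hy h
    rw [← metricForm_apply, hu] at this
    simp at this
  have hdim : Module.finrank ℝ E = Module.finrank ℝ (E →L[ℝ] ℝ) := by
    rw [← (LinearMap.toContinuousLinearMap (𝕜 := ℝ) (E := E) (F' := ℝ)).finrank_eq]
    exact (Subspace.dual_finrank_eq).symm
  refine ⟨(LinearEquiv.ofInjectiveOfFinrankEq (metricForm x₀ y).toLinearMap hinj
    hdim).toContinuousLinearEquiv, ?_⟩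
  ext u v
  rfl

variable [IsContMDiffRiemannianBundle 𝓘(ℝ, E) ∞ E (fun x : M => TangentSpace 𝓘(ℝ, E) x)]

/-- The coordinate fields are smooth sections, being images of constant fields under the tangent map
of the inverse chart; the metric is smooth on pairs of smooth sections. -/
theorem contDiffOn_coordMetric (x₀ : M) (u v : E) :
    ContDiffOn ℝ ∞ (fun y => coordMetric x₀ y u v) (extChartAt 𝓘(ℝ, E) x₀).target := by
  have : IsManifold 𝓘(ℝ, E) 1 M := IsManifold.of_le (n := ∞) (by simp)
  have hopen := isOpen_extChartAt_target (I := 𝓘(ℝ, E)) x₀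
  have hsec : ∀ w : E, ContMDiffOn 𝓘(ℝ, E) 𝓘(ℝ, E).tangent ∞
      (fun y => (⟨(extChartAt 𝓘(ℝ, E) x₀).symm y,
        mfderiv 𝓘(ℝ, E) 𝓘(ℝ, E) (extChartAt 𝓘(ℝ, E) x₀).symm y w⟩ : TangentBundle 𝓘(ℝ, E) M))
      (extChartAt 𝓘(ℝ, E) x₀).target := by
    intro w
    have h := (contMDiffOn_extChartAt_symm (I := 𝓘(ℝ, E)) (n := ∞) x₀).contMDiffOn_tangentMapWithin
      (m := ∞) (by simp) hopen.uniqueMDiffOn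
    have hc : ContMDiffOn 𝓘(ℝ, E) 𝓘(ℝ, E).tangent ∞
        (fun y : E => (⟨y, w⟩ : TangentBundle 𝓘(ℝ, E) E)) (extChartAt 𝓘(ℝ, E) x₀).target := by
      rw [contMDiffOn_vectorSpace_iff_contDiffOn (V := fun _ => w)]
      exact contDiffOn_const
    refine (h.comp hc fun y hy => hy).congr fun y hy => ?_
    simp only [Function.comp, tangentMapWithin, mfderivWithin_of_isOpen hopen hy]
  rw [← contMDiffOn_iff_contDiffOn]
  exact ContMDiffOn.inner_bundle (hsec u) (hsec v)

variable [FiniteDimensional ℝ E]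

theorem contDiffOn_metricForm (x₀ : M) :
    ContDiffOn ℝ ∞ (metricForm (E := E) x₀) (extChartAt 𝓘(ℝ, E) x₀).target := by
  rw [contDiffOn_clm_apply]
  intro u
  rw [contDiffOn_clm_apply]
  exact fun v => contDiffOn_coordMetric x₀ u v

theorem contDiffAt_metricForm {x₀ : M} {y : E} (hy : y ∈ (extChartAt 𝓘(ℝ, E) x₀).target) :
    ContDiffAt ℝ ∞ (metricForm (E := E) x₀) y :=
  (contDiffOn_metricForm x₀).contDiffAt ((isOpen_extChartAt_target (I := 𝓘(ℝ, E)) x₀).mem_nhds hy)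

theorem differentiableAt_metricForm {x₀ : M} {y : E} (hy : y ∈ (extChartAt 𝓘(ℝ, E) x₀).target) :
    DifferentiableAt ℝ (metricForm (E := E) x₀) y :=
  (contDiffAt_metricForm hy).differentiableAt (by simp)

-- Smoothness of the metric permits differentiating the whole form at once instead of its scalar
-- components, which makes the general results on bilinear forms available.
set_option synthInstance.maxHeartbeats 200000 in
theorem christoffel_eq {x₀ : M} {y : E} (hy : y ∈ (extChartAt 𝓘(ℝ, E) x₀).target) (u v z : E) :
    christoffel x₀ y u v z = christoffelForm (metricForm x₀) y u v z := by
  have h1 : ∀ a b c : E, fderiv ℝ (fun y' => coordMetric x₀ y' b c) y a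
      = fderiv ℝ (metricForm (E := E) x₀) y a b c := by
    intro a b c
    have h := ((differentiableAt_metricForm hy).hasFDerivAt.clm_apply
      (hasFDerivAt_const b y)).clm_apply (hasFDerivAt_const c y)
    have h' : HasFDerivAt (fun y' => coordMetric x₀ y' b c) _ y := h
    rw [h'.fderiv]
    simp
  rw [christoffel, christoffelForm_apply, h1, h1, h1]

end Metric

end Coordinates

end

end RMarina

namespace RMarina

noncomputable section

/-! ### Parallel fields: chart independence, metric compatibility, uniqueness. -/

section ParallelFields

open Topology Filter Set

variable {E : Type*} [NormedAddCommGroup E] [NormedSpace ℝ E] [FiniteDimensional ℝ E]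
  {M : Type*} [TopologicalSpace M] [ChartedSpace E M] [IsManifold 𝓘(ℝ, E) ∞ M]
  [RiemannianBundle (fun x : M => TangentSpace 𝓘(ℝ, E) x)]
  [IsContMDiffRiemannianBundle 𝓘(ℝ, E) ∞ E (fun x : M => TangentSpace 𝓘(ℝ, E) x)]
  {γ : ℝ → M} {V W : ∀ t, TangentSpace 𝓘(ℝ, E) (γ t)} {t : ℝ}

omit [FiniteDimensional ℝ E] [IsManifold 𝓘(ℝ, E) ∞ M]
  [IsContMDiffRiemannianBundle 𝓘(ℝ, E) ∞ E (fun x : M => TangentSpace 𝓘(ℝ, E) x)] in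
/-- The equation of parallel fields at the time `t`, in the chart around `x₀`. -/
def IsParallelInChart (x₀ : M) (γ : ℝ → M) (V : ∀ t, TangentSpace 𝓘(ℝ, E) (γ t)) (t : ℝ) : Prop :=
  DifferentiableAt ℝ (coordField x₀ γ V) t ∧
    ∀ z : E, metricForm x₀ (extChartAt 𝓘(ℝ, E) x₀ (γ t)) (deriv (coordField x₀ γ V) t) z
      + christoffelForm (metricForm x₀) (extChartAt 𝓘(ℝ, E) x₀ (γ t))
        (deriv (fun s => extChartAt 𝓘(ℝ, E) x₀ (γ s)) t) (coordField x₀ γ V t) z = 0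

/-- The field `V` along `γ` is parallel at the time `t`. -/
def IsParallelAt (γ : ℝ → M) (V : ∀ t, TangentSpace 𝓘(ℝ, E) (γ t)) (t : ℝ) : Prop :=
  ∀ x₀ : M, γ t ∈ (chartAt E x₀).source → IsParallelInChart x₀ γ V t

omit [FiniteDimensional ℝ E] [IsManifold 𝓘(ℝ, E) ∞ M]
  [RiemannianBundle (fun x : M => TangentSpace 𝓘(ℝ, E) x)]
  [IsContMDiffRiemannianBundle 𝓘(ℝ, E) ∞ E (fun x : M => TangentSpace 𝓘(ℝ, E) x)] in
theorem chart_mem_target {x₀ x : M} (h : x ∈ (chartAt E x₀).source) :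
    extChartAt 𝓘(ℝ, E) x₀ x ∈ (extChartAt 𝓘(ℝ, E) x₀).target :=
  (extChartAt 𝓘(ℝ, E) x₀).map_source (by rwa [extChartAt_source])

omit [FiniteDimensional ℝ E] [IsManifold 𝓘(ℝ, E) ∞ M]
  [RiemannianBundle (fun x : M => TangentSpace 𝓘(ℝ, E) x)]
  [IsContMDiffRiemannianBundle 𝓘(ℝ, E) ∞ E (fun x : M => TangentSpace 𝓘(ℝ, E) x)] in
theorem chart_left_inv {x₀ x : M} (h : x ∈ (chartAt E x₀).source) :
    (extChartAt 𝓘(ℝ, E) x₀).symm (extChartAt 𝓘(ℝ, E) x₀ x) = x :=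
  (extChartAt 𝓘(ℝ, E) x₀).left_inv (by rwa [extChartAt_source])

/-- Localizing the equation in time is what allows solutions on intervals to be compared and glued.
-/
theorem isParallel_iff_forall_isParallelAt (hγ : ContMDiff 𝓘(ℝ, ℝ) 𝓘(ℝ, E) ∞ γ) :
    IsParallel γ V ↔ ∀ t, IsParallelAt γ V t := by
  have key : ∀ (x₀ : M) (t : ℝ), γ t ∈ (chartAt E x₀).source → ∀ z,
      christoffel x₀ (extChartAt 𝓘(ℝ, E) x₀ (γ t))
            (coordField x₀ γ (velocity γ) t) (coordField x₀ γ V t) z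
      = christoffelForm (metricForm x₀) (extChartAt 𝓘(ℝ, E) x₀ (γ t))
        (deriv (fun s => extChartAt 𝓘(ℝ, E) x₀ (γ s)) t) (coordField x₀ γ V t) z := by
    intro x₀ t h z
    rw [christoffel_eq (chart_mem_target h),
      coordField_velocity ((hγ t).mdifferentiableAt (by simp)) h]
  constructor
  · intro h t x₀ hx
    refine ⟨(h x₀ t hx).1, fun z => ?_⟩
    rw [← key x₀ t hx z]
    exact (h x₀ t hx).2 z
  · intro h x₀ t hx
    refine ⟨(h t x₀ hx).1, fun z => ?_⟩
    rw [key x₀ t hx z]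
    exact (h t x₀ hx).2 z

omit [FiniteDimensional ℝ E] [IsManifold 𝓘(ℝ, E) ∞ M]
  [IsContMDiffRiemannianBundle 𝓘(ℝ, E) ∞ E (fun x : M => TangentSpace 𝓘(ℝ, E) x)] in
theorem metricForm_symm (x₀ : M) (y u v : E) : metricForm x₀ y u v = metricForm x₀ y v u :=
  coordMetric_symm x₀ y u v

/-- Being parallel does not depend on the chart. -/
theorem IsParallelInChart.change_chart (hγ : ContMDiff 𝓘(ℝ, ℝ) 𝓘(ℝ, E) ∞ γ) {x₀ x₁ : M}
    (h₀ : γ t ∈ (chartAt E x₀).source) (h₁ : γ t ∈ (chartAt E x₁).source)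
    (h : IsParallelInChart x₀ γ V t) : IsParallelInChart x₁ γ V t := by
  obtain ⟨hd, heq⟩ := h
  set c := fun s => extChartAt 𝓘(ℝ, E) x₀ (γ s) with hc
  have hy : c t ∈ (extChartAt 𝓘(ℝ, E) x₀).target := chart_mem_target h₀
  have hinv : (extChartAt 𝓘(ℝ, E) x₀).symm (c t) = γ t := chart_left_inv h₀
  have hx : (extChartAt 𝓘(ℝ, E) x₀).symm (c t) ∈ (chartAt E x₁).source := by rwa [hinv]
  have hφt : transition x₀ x₁ (c t) = extChartAt 𝓘(ℝ, E) x₁ (γ t) := by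
    rw [transition, hinv]
  have hφ : ContDiffAt ℝ ∞ (transition x₀ x₁) (c t) := contDiffAt_transition hy hx
  have hφ1 : DifferentiableAt ℝ (transition x₀ x₁) (c t) := hφ.differentiableAt (by simp)
  have hφ2 : DifferentiableAt ℝ (fderiv ℝ (transition x₀ x₁)) (c t) :=
    (hφ.fderiv_right (m := 1) (by norm_cast)).differentiableAt (by norm_num)
  have hct : HasDerivAt c (deriv c t) t :=
    ((contDiffAt_chart_comp hγ h₀).differentiableAt (by simp)).hasDerivAt
  have hev : ∀ᶠ s in 𝓝 t, γ s ∈ (chartAt E x₀).source ∧ γ s ∈ (chartAt E x₁).source :=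
    (hγ.continuous.continuousAt.eventually ((chartAt E x₀).open_source.eventually_mem h₀)).and
      (hγ.continuous.continuousAt.eventually ((chartAt E x₁).open_source.eventually_mem h₁))
  have hV : coordField x₁ γ V
      =ᶠ[𝓝 t] fun s => fderiv ℝ (transition x₀ x₁) (c s) (coordField x₀ γ V s) :=
    hev.mono fun s hs => coordField_transition V hs.1 hs.2
  have hcc : (fun s => extChartAt 𝓘(ℝ, E) x₁ (γ s)) =ᶠ[𝓝 t] fun s => transition x₀ x₁ (c s) := by
    refine hev.mono fun s hs => ?_
    simp only [transition, hc, chart_left_inv hs.1]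
  have hVd : HasDerivAt (fun s => fderiv ℝ (transition x₀ x₁) (c s) (coordField x₀ γ V s))
      (fderiv ℝ (fderiv ℝ (transition x₀ x₁)) (c t) (deriv c t) (coordField x₀ γ V t)
        + fderiv ℝ (transition x₀ x₁) (c t) (deriv (coordField x₀ γ V) t)) t :=
    (hφ2.hasFDerivAt.comp_hasDerivAt t hct).clm_apply hd.hasDerivAt
  have hcd : deriv (fun s => extChartAt 𝓘(ℝ, E) x₁ (γ s)) t
      = fderiv ℝ (transition x₀ x₁) (c t) (deriv c t) := by
    rw [hcc.deriv_eq]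
    exact (hφ1.hasFDerivAt.comp_hasDerivAt t hct).deriv
  refine ⟨hV.differentiableAt_iff.2 hVd.differentiableAt, fun z => ?_⟩
  -- Surjectivity of the derivative of the coordinate change: the rule for coordinates of fields is
  -- applied to the constant curve at `γ t`, with the vector whose coordinates in the second chart
  -- are `z`.
  obtain ⟨z', rfl⟩ : ∃ z', fderiv ℝ (transition x₀ x₁) (c t) z' = z := by
    have h3 := coordField_transition (x₀ := x₀) (x₁ := x₁) (γ := fun _ => γ t) (t := t)
      (fun _ => mfderiv 𝓘(ℝ, E) 𝓘(ℝ, E) (extChartAt 𝓘(ℝ, E) x₁).symm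
        (extChartAt 𝓘(ℝ, E) x₁ (γ t)) z) h₀ h₁
    refine ⟨_, h3.symm.trans ?_⟩
    have h4 := congrArg (fun A => A z) (chart_mfderiv_comp_symm (chart_mem_target h₁))
    rw [chart_left_inv h₁] at h4
    exact h4
  have hpull := christoffelForm_pullback (G := metricForm x₀) (H := metricForm x₁)
    (φ := transition x₀ x₁) (y := c t) (hφ.of_le (by norm_cast))
    (differentiableAt_metricForm hy)
    (differentiableAt_metricForm (by rw [hφt]; exact chart_mem_target h₁))
    (fun v w => metricForm_symm x₁ _ v w)
    ((eventually_transition hy hx).mono fun y' h u v => metricForm_transition h.1 h.2 u v)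
    (deriv c t) (coordField x₀ γ V t) z'
  have hmet := metricForm_transition hy hx (deriv (coordField x₀ γ V) t) z'
  have heq' := heq z'
  -- The D²φ term produced by differentiating the coordinates of `V` is exactly the correction term
  -- in `hpull`.
  rw [hcd, hV.deriv_eq, hVd.deriv, hV.eq_of_nhds, ← hφt, map_add, add_apply]
  rw [hmet, hpull] at heq'
  linarith

theorem isParallelAt_of_isParallelInChart (hγ : ContMDiff 𝓘(ℝ, ℝ) 𝓘(ℝ, E) ∞ γ) {x₀ : M}
    (h₀ : γ t ∈ (chartAt E x₀).source) (h : IsParallelInChart x₀ γ V t) : IsParallelAt γ V t :=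
  fun _ h₁ => h.change_chart hγ h₀ h₁

omit [FiniteDimensional ℝ E] [IsManifold 𝓘(ℝ, E) ∞ M]
  [IsContMDiffRiemannianBundle 𝓘(ℝ, E) ∞ E (fun x : M => TangentSpace 𝓘(ℝ, E) x)] in
theorem IsParallelAt.congr (h : IsParallelAt γ V t) (hVW : ∀ᶠ s in 𝓝 t, V s = W s) :
    IsParallelAt γ W t := by
  intro x₀ hx
  obtain ⟨hd, heq⟩ := h x₀ hx
  have hc : coordField x₀ γ V =ᶠ[𝓝 t] coordField x₀ γ W :=
    hVW.mono fun s hs => congrArg _ hs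
  refine ⟨hc.differentiableAt_iff.1 hd, fun z => ?_⟩
  rw [← hc.deriv_eq, ← hc.eq_of_nhds]
  exact heq z

omit [FiniteDimensional ℝ E] [IsManifold 𝓘(ℝ, E) ∞ M]
  [IsContMDiffRiemannianBundle 𝓘(ℝ, E) ∞ E (fun x : M => TangentSpace 𝓘(ℝ, E) x)] in
theorem IsParallelAt.add (hV : IsParallelAt γ V t) (hW : IsParallelAt γ W t) :
    IsParallelAt γ (fun s => V s + W s) t := by
  intro x₀ hx
  obtain ⟨hd, heq⟩ := hV x₀ hx
  obtain ⟨hd', heq'⟩ := hW x₀ hx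
  have hc : coordField x₀ γ (fun s => V s + W s)
      = fun s => coordField x₀ γ V s + coordField x₀ γ W s := by
    funext s
    exact map_add _ _ _
  rw [IsParallelInChart, hc]
  refine ⟨hd.add hd', fun z => ?_⟩
  have h1 : deriv (fun s => coordField x₀ γ V s + coordField x₀ γ W s) t
      = deriv (coordField x₀ γ V) t + deriv (coordField x₀ γ W) t :=
    (hd.hasDerivAt.add hd'.hasDerivAt).deriv
  rw [h1, map_add, map_add, add_apply, add_apply]
  linarith [heq z, heq' z]

omit [FiniteDimensional ℝ E] [IsManifold 𝓘(ℝ, E) ∞ M]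
  [IsContMDiffRiemannianBundle 𝓘(ℝ, E) ∞ E (fun x : M => TangentSpace 𝓘(ℝ, E) x)] in
theorem IsParallelAt.const_smul (hV : IsParallelAt γ V t) (a : ℝ) :
    IsParallelAt γ (fun s => a • V s) t := by
  intro x₀ hx
  obtain ⟨hd, heq⟩ := hV x₀ hx
  have hc : coordField x₀ γ (fun s => a • V s) = fun s => a • coordField x₀ γ V s := by
    funext s
    exact map_smul _ _ _
  rw [IsParallelInChart, hc]
  refine ⟨hd.const_smul a, fun z => ?_⟩
  have h1 : deriv (fun s => a • coordField x₀ γ V s) t = a • deriv (coordField x₀ γ V) t :=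
    (hd.hasDerivAt.const_smul a).deriv
  rw [h1, map_smul, map_smul, smul_apply, smul_apply,
    ← smul_add, heq z, smul_zero]

/-- The inner product of two parallel fields has derivative zero. -/
theorem IsParallelAt.hasDerivAt_inner (hγ : ContMDiff 𝓘(ℝ, ℝ) 𝓘(ℝ, E) ∞ γ)
    (hV : IsParallelAt γ V t) (hW : IsParallelAt γ W t) :
    HasDerivAt (fun s => inner ℝ (V s) (W s)) 0 t := by
  have h₀ : γ t ∈ (chartAt E (γ t)).source := mem_chart_source E (γ t)
  obtain ⟨hd, heq⟩ := hV (γ t) h₀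
  obtain ⟨hd', heq'⟩ := hW (γ t) h₀
  set x₀ := γ t with hx₀
  set c := fun s => extChartAt 𝓘(ℝ, E) x₀ (γ s) with hc
  have hy : c t ∈ (extChartAt 𝓘(ℝ, E) x₀).target := chart_mem_target h₀
  have hct : HasDerivAt c (deriv c t) t :=
    ((contDiffAt_chart_comp hγ h₀).differentiableAt (by simp)).hasDerivAt
  have hev : (fun s => inner ℝ (V s) (W s)) =ᶠ[𝓝 t]
      fun s => metricForm x₀ (c s) (coordField x₀ γ V s) (coordField x₀ γ W s) := by
    refine (hγ.continuous.continuousAt.eventually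
      ((chartAt E x₀).open_source.eventually_mem h₀)).mono fun s hs => ?_
    exact (coordMetric_coordField hs V W).symm
  have hG := differentiableAt_metricForm hy
  have h1 := hasDerivAt_bilinear_comp hG hct hd.hasDerivAt hd'.hasDerivAt
  have h2 := christoffelForm_add_swap (fderiv_symm_of_eventually hG
    (Eventually.of_forall fun y' v w => metricForm_symm x₀ y' v w)) (deriv c t)
    (coordField x₀ γ V t) (coordField x₀ γ W t)
  have e1 := heq (coordField x₀ γ W t)
  have e2 := heq' (coordField x₀ γ V t)
  rw [metricForm_symm] at e2
  -- By `h2` the derivative of the metric splits into two Christoffel terms; each cancels one of the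
  -- terms with V' or W' through the parallel equations.
  refine (hev.hasDerivAt_iff.2 (h1.congr_deriv ?_))
  rw [← h2]
  linarith

theorem inner_eq_of_isParallelAt (hγ : ContMDiff 𝓘(ℝ, ℝ) 𝓘(ℝ, E) ∞ γ) {I : Set ℝ} (hI : IsOpen I)
    (hI' : I.OrdConnected) (hV : ∀ t ∈ I, IsParallelAt γ V t) (hW : ∀ t ∈ I, IsParallelAt γ W t)
    {a b : ℝ} (ha : a ∈ I) (hb : b ∈ I) : inner ℝ (V a) (W a) = inner ℝ (V b) (W b) := by
  have h : ∀ t ∈ I, HasDerivAt (fun s => inner ℝ (V s) (W s)) 0 t := fun t ht =>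
    (hV t ht).hasDerivAt_inner hγ (hW t ht)
  exact hI.is_const_of_deriv_eq_zero (f := fun s => inner ℝ (V s) (W s)) hI'.isPreconnected
    (fun t ht => (h t ht).differentiableAt.differentiableWithinAt) (fun t ht => (h t ht).deriv)
    ha hb

/-- Two parallel fields that agree at one time agree everywhere. -/
theorem eq_of_isParallelAt (hγ : ContMDiff 𝓘(ℝ, ℝ) 𝓘(ℝ, E) ∞ γ) {I : Set ℝ} (hI : IsOpen I)
    (hI' : I.OrdConnected) (hV : ∀ t ∈ I, IsParallelAt γ V t) (hW : ∀ t ∈ I, IsParallelAt γ W t)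
    {a b : ℝ} (ha : a ∈ I) (hb : b ∈ I) (h : V a = W a) : V b = W b := by
  -- Uniqueness uses metric compatibility instead of ODE theory: the difference is parallel, so its
  -- norm is constant, and it vanishes at `a`.
  have hD : ∀ t ∈ I, IsParallelAt γ (fun s => V s + (-1 : ℝ) • W s) t := fun t ht =>
    (hV t ht).add ((hW t ht).const_smul _)
  have h1 := inner_eq_of_isParallelAt hγ hI hI' hD hD ha hb
  simp only [h, neg_smul, one_smul, add_neg_cancel, inner_zero_left] at h1
  rw [← sub_eq_zero, sub_eq_add_neg]
  exact inner_self_eq_zero.1 h1.symm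

end ParallelFields

end

end RMarina

namespace RMarina

noncomputable section

/-! ### Continuity of the coefficients of the parallel equation. -/

section ContinuityOfCoefficients

open Topology Filter

variable {E : Type*} [NormedAddCommGroup E] [NormedSpace ℝ E]

set_option maxSynthPendingDepth 3 in
set_option synthInstance.maxHeartbeats 200000 in
theorem continuousAt_christoffelForm {G : E → E →L[ℝ] E →L[ℝ] ℝ} {c u : ℝ → E} {t : ℝ}
    (hG : ContinuousAt (fderiv ℝ G) (c t)) (hc : ContinuousAt c t) (hu : ContinuousAt u t) :
    ContinuousAt (fun s => christoffelForm G (c s) (u s)) t := by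
  have hD : ContinuousAt (fun s => fderiv ℝ G (c s)) t :=
    ContinuousAt.comp (g := fderiv ℝ G) (f := c) hG hc
  have hF : ContinuousAt (fun s => (fderiv ℝ G (c s)).flip (u s)) t := by
    have h : ContinuousAt (fun s => (fderiv ℝ G (c s)).flip) t :=
      (ContinuousLinearMap.flipₗᵢ ℝ E E (E →L[ℝ] ℝ)).continuous.continuousAt.comp hD
    exact h.clm_apply hu
  have hFF : ContinuousAt (fun s => ((fderiv ℝ G (c s)).flip (u s)).flip) t :=
    (ContinuousLinearMap.flipₗᵢ ℝ E E ℝ).continuous.continuousAt.comp hF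
  unfold christoffelForm
  exact ContinuousAt.const_smul (((hD.clm_apply hu).add hF).sub hFF) (1 / 2 : ℝ)

theorem continuousAt_inverse_comp [CompleteSpace E] {G : E → E →L[ℝ] E →L[ℝ] ℝ} {c : ℝ → E}
    {t : ℝ} (hG : ContinuousAt G (c t)) (hc : ContinuousAt c t) (hinv : (G (c t)).IsInvertible) :
    ContinuousAt (fun s => (G (c s)).inverse) t := by
  have h1 : ContinuousAt (fun s => G (c s)) t := ContinuousAt.comp (g := G) (f := c) hG hc
  have h2 : ContinuousAt (ContinuousLinearMap.inverse : (E →L[ℝ] E →L[ℝ] ℝ) → _) (G (c t)) := by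
    obtain ⟨e, he⟩ := hinv
    rw [← he]
    exact (contDiffAt_map_inverse (n := 0) e).continuousAt
  exact ContinuousAt.comp (f := fun s => G (c s)) h2 h1

end ContinuityOfCoefficients

/-! ### Global existence of parallel fields and isometry of parallel transport. -/

section ExistenceOfParallelFields

open Topology Filter Set

variable {E : Type*} [NormedAddCommGroup E] [NormedSpace ℝ E] [FiniteDimensional ℝ E]
  {M : Type*} [TopologicalSpace M] [ChartedSpace E M] [IsManifold 𝓘(ℝ, E) ∞ M]
  [RiemannianBundle (fun x : M => TangentSpace 𝓘(ℝ, E) x)]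
  [IsContMDiffRiemannianBundle 𝓘(ℝ, E) ∞ E (fun x : M => TangentSpace 𝓘(ℝ, E) x)]
  {γ : ℝ → M} {V W : ∀ t, TangentSpace 𝓘(ℝ, E) (γ t)}

/-- Local existence of parallel fields, for initial conditions at all times of an interval. -/
theorem exists_isParallelAt_Ioo (hγ : ContMDiff 𝓘(ℝ, ℝ) 𝓘(ℝ, E) ∞ γ) (t₀ : ℝ) :
    ∃ ε > 0, ∀ t₁ ∈ Ioo (t₀ - ε) (t₀ + ε), ∀ w : TangentSpace 𝓘(ℝ, E) (γ t₁),
      ∃ V : ∀ t, TangentSpace 𝓘(ℝ, E) (γ t), V t₁ = w ∧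
        ∀ t ∈ Ioo (t₀ - ε) (t₀ + ε), IsParallelAt γ V t := by
  have : IsManifold 𝓘(ℝ, E) 1 M := IsManifold.of_le (n := ∞) (by simp)
  have : CompleteSpace E := FiniteDimensional.complete ℝ E
  set x₀ := γ t₀ with hx₀
  set c := fun s => extChartAt 𝓘(ℝ, E) x₀ (γ s) with hc
  set G := metricForm (E := E) x₀ with hG
  have hsrc : ∀ᶠ s in 𝓝 t₀, γ s ∈ (chartAt E x₀).source :=
    hγ.continuous.continuousAt.eventually
      ((chartAt E x₀).open_source.eventually_mem (mem_chart_source E (γ t₀)))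
  -- The parallel equation solved for the derivative: V' = -G⁻¹ Γ(c', V).
  set A : ℝ → E →L[ℝ] E := fun s =>
    -((G (c s)).inverse.comp (christoffelForm G (c s) (deriv c s))) with hA
  have hcont : ∀ s, γ s ∈ (chartAt E x₀).source → ContinuousAt A s := by
    intro s hs
    have hy : c s ∈ (extChartAt 𝓘(ℝ, E) x₀).target := chart_mem_target hs
    have hcs := contDiffAt_chart_comp hγ hs
    have hdc : ContinuousAt (deriv c) s :=
      (hcs.continuousAt_fderiv (by simp)).clm_apply continuousAt_const
    have h1 := continuousAt_inverse_comp (contDiffAt_metricForm hy).continuousAt hcs.continuousAt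
      (metricForm_isInvertible hy)
    have h2 := continuousAt_christoffelForm
      ((contDiffAt_metricForm hy).continuousAt_fderiv (by simp)) hcs.continuousAt hdc
    exact (h1.clm_comp h2).neg
  obtain ⟨δ, hδ, hode⟩ := exists_forall_hasDerivAt_linear (hsrc.mono hcont)
  obtain ⟨δ', hδ', hball⟩ := Metric.eventually_nhds_iff.1 hsrc
  refine ⟨min δ δ', lt_min hδ hδ', fun t₁ ht₁ w => ?_⟩
  have hsub : Ioo (t₀ - min δ δ') (t₀ + min δ δ') ⊆ Ioo (t₀ - δ) (t₀ + δ) :=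
    Ioo_subset_Ioo (by linarith [min_le_left δ δ']) (by linarith [min_le_left δ δ'])
  have hmem : ∀ t ∈ Ioo (t₀ - min δ δ') (t₀ + min δ δ'), γ t ∈ (chartAt E x₀).source := by
    intro t ht
    refine hball ?_
    rw [Real.dist_eq, abs_lt]
    constructor <;> linarith [ht.1, ht.2, min_le_right δ δ']
  have hinv : ∀ t ∈ Ioo (t₀ - min δ δ') (t₀ + min δ δ'),
      (mfderiv 𝓘(ℝ, E) 𝓘(ℝ, E) (extChartAt 𝓘(ℝ, E) x₀) (γ t)).IsInvertible := fun t ht =>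
    isInvertible_mfderiv_extChartAt (by rw [extChartAt_source]; exact hmem t ht)
  obtain ⟨α, hα0, hα⟩ := hode t₁ (hsub ht₁)
    (mfderiv 𝓘(ℝ, E) 𝓘(ℝ, E) (extChartAt 𝓘(ℝ, E) x₀) (γ t₁) w)
  set V : ∀ t, TangentSpace 𝓘(ℝ, E) (γ t) := fun t =>
    (mfderiv 𝓘(ℝ, E) 𝓘(ℝ, E) (extChartAt 𝓘(ℝ, E) x₀) (γ t)).inverse (α t) with hV
  have hcoord : ∀ t ∈ Ioo (t₀ - min δ δ') (t₀ + min δ δ'), coordField x₀ γ V t = α t :=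
    fun t ht => (hinv t ht).self_apply_inverse _
  refine ⟨V, ?_, fun t ht => ?_⟩
  · simp only [hV, hα0]
    exact (hinv t₁ ht₁).inverse_apply_self w
  · refine isParallelAt_of_isParallelInChart hγ (hmem t ht) ?_
    have hev : coordField x₀ γ V =ᶠ[𝓝 t] α := by
      filter_upwards [isOpen_Ioo.mem_nhds ht] with s hs using hcoord s hs
    have hd := hα t (hsub ht)
    refine ⟨hev.differentiableAt_iff.2 hd.differentiableAt, fun z => ?_⟩
    rw [hev.deriv_eq, hd.deriv, hcoord t ht]
    have hy : c t ∈ (extChartAt 𝓘(ℝ, E) x₀).target := chart_mem_target (hmem t ht)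
    have h1 : G (c t) (A t (α t)) = -christoffelForm G (c t) (deriv c t) (α t) := by
      simp only [hA, neg_apply, ContinuousLinearMap.comp_apply, map_neg]
      rw [(metricForm_isInvertible hy).self_apply_inverse]
    change G (c t) (A t (α t)) z + christoffelForm G (c t) (deriv c t) (α t) z = 0
    rw [h1, neg_apply, neg_add_cancel]

/-- Parallel fields on two intervals that agree at a common time can be glued. -/
theorem exists_isParallelAt_union (hγ : ContMDiff 𝓘(ℝ, ℝ) 𝓘(ℝ, E) ∞ γ) {I J : Set ℝ}
    (hI : IsOpen I) (hI' : I.OrdConnected) (hJ : IsOpen J) (hJ' : J.OrdConnected)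
    (hV : ∀ t ∈ I, IsParallelAt γ V t) (hW : ∀ t ∈ J, IsParallelAt γ W t)
    {b : ℝ} (hbI : b ∈ I) (hbJ : b ∈ J) (h : V b = W b) :
    ∃ Z : ∀ t, TangentSpace 𝓘(ℝ, E) (γ t), (∀ t ∈ I, Z t = V t) ∧
      ∀ t ∈ I ∪ J, IsParallelAt γ Z t := by
  classical
  refine ⟨fun t => if t ∈ I then V t else W t, fun t ht => if_pos ht, ?_⟩
  -- Both fields are parallel on the interval I ∩ J, which contains `b`, so uniqueness makes them
  -- agree there.
  have hag : ∀ t ∈ J, (if t ∈ I then V t else W t) = W t := by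
    intro t ht
    split_ifs with htI
    · exact eq_of_isParallelAt hγ (hI.inter hJ) (hI'.inter hJ') (fun s hs => hV s hs.1)
        (fun s hs => hW s hs.2) ⟨hbI, hbJ⟩ ⟨htI, ht⟩ h
    · rfl
  rintro t (ht | ht)
  · refine (hV t ht).congr ?_
    filter_upwards [hI.mem_nhds ht] with s hs using (if_pos hs).symm
  · refine (hW t ht).congr ?_
    filter_upwards [hJ.mem_nhds ht] with s hs using (hag s hs).symm

/-- Global existence of parallel fields along a smooth curve. -/
theorem exists_forall_isParallelAt (hγ : ContMDiff 𝓘(ℝ, ℝ) 𝓘(ℝ, E) ∞ γ) (a : ℝ)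
    (w : TangentSpace 𝓘(ℝ, E) (γ a)) :
    ∃ V : ∀ t, TangentSpace 𝓘(ℝ, E) (γ t), V a = w ∧ ∀ t, IsParallelAt γ V t := by
  classical
  -- The open intervals around `a` that carry a solution. Their union is shown to be such an
  -- interval itself and to be closed, hence all of ℝ.
  let F : Set (Set ℝ) := {I | IsOpen I ∧ I.OrdConnected ∧ a ∈ I ∧
    ∃ V : ∀ t, TangentSpace 𝓘(ℝ, E) (γ t), V a = w ∧ ∀ t ∈ I, IsParallelAt γ V t}
  choose! sol hsol0 hsol using fun I (hI : I ∈ F) => hI.2.2.2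
  have hag : ∀ I ∈ F, ∀ J ∈ F, ∀ t ∈ I, t ∈ J → sol I t = sol J t := by
    intro I hI J hJ t htI htJ
    exact eq_of_isParallelAt hγ (hI.1.inter hJ.1) (hI.2.1.inter hJ.2.1)
      (fun s hs => hsol I hI s hs.1) (fun s hs => hsol J hJ s hs.2) ⟨hI.2.2.1, hJ.2.2.1⟩
      ⟨htI, htJ⟩ ((hsol0 I hI).trans (hsol0 J hJ).symm)
  have hU : IsOpen (⋃₀ F) := isOpen_sUnion fun I hI => hI.1
  have hU' : (⋃₀ F).OrdConnected := by
    refine isPreconnected_iff_ordConnected.1 (isPreconnected_sUnion a F (fun I hI => hI.2.2.1)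
      fun I hI => hI.2.1.isPreconnected)
  obtain ⟨ε, hε, hloc⟩ := exists_isParallelAt_Ioo hγ a
  have haε : a ∈ Ioo (a - ε) (a + ε) := ⟨by linarith, by linarith⟩
  have hF0 : Ioo (a - ε) (a + ε) ∈ F := ⟨isOpen_Ioo, ordConnected_Ioo, haε, hloc a haε w⟩
  have haU : a ∈ ⋃₀ F := ⟨_, hF0, haε⟩
  have hUF : ⋃₀ F ∈ F := by
    -- At each time the solution of some chosen member of `F` is used; `hag` makes the choice
    -- immaterial, and 0 is a filler outside the union.
    refine ⟨hU, hU', haU, fun t => if h : ∃ I ∈ F, t ∈ I then sol h.choose t else 0, ?_, ?_⟩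
    · have h : ∃ I ∈ F, a ∈ I := ⟨_, hF0, haε⟩
      simp only [dif_pos h]
      exact hsol0 _ h.choose_spec.1
    · rintro t ⟨I, hI, ht⟩
      refine (hsol I hI t ht).congr ?_
      filter_upwards [hI.1.mem_nhds ht] with s hs
      have h : ∃ I ∈ F, s ∈ I := ⟨I, hI, hs⟩
      rw [dif_pos h]
      exact hag I hI _ h.choose_spec.1 s hs h.choose_spec.2
  have hclosed : IsClosed (⋃₀ F) := by
    refine isClosed_of_closure_subset fun t₀ ht₀ => ?_
    obtain ⟨δ, hδ, hloc'⟩ := exists_isParallelAt_Ioo hγ t₀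
    have ht₀δ : t₀ ∈ Ioo (t₀ - δ) (t₀ + δ) := ⟨by linarith, by linarith⟩
    obtain ⟨b, hbJ, hbU⟩ := mem_closure_iff.1 ht₀ _ isOpen_Ioo ht₀δ
    -- The local solution near the limit time `t₀` starts from the earlier solution at `b`. This
    -- needs local existence from every time of the interval, not only from its centre.
    obtain ⟨W, hWb, hW⟩ := hloc' b hbJ (sol (⋃₀ F) b)
    obtain ⟨Z, hZ, hZpar⟩ := exists_isParallelAt_union hγ hU hU' isOpen_Ioo ordConnected_Ioo
      (hsol _ hUF) hW hbU hbJ hWb.symm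
    refine ⟨⋃₀ F ∪ Ioo (t₀ - δ) (t₀ + δ), ⟨hU.union isOpen_Ioo, ?_, Or.inl haU, Z, ?_, hZpar⟩,
      Or.inr ht₀δ⟩
    · exact isPreconnected_iff_ordConnected.1
        (IsPreconnected.union b hbU hbJ hU'.isPreconnected isPreconnected_Ioo)
    · rw [hZ a haU, hsol0 _ hUF]
  have huniv : ⋃₀ F = univ := IsClopen.eq_univ ⟨hclosed, hU⟩ ⟨a, haU⟩
  exact ⟨sol (⋃₀ F), hsol0 _ hUF, fun t => hsol _ hUF t (huniv ▸ mem_univ t)⟩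

/-- Global existence selects the first branch of the definition, whose chosen field does not depend
on the end time; all transports from `a` are thus values of one parallel field. -/
theorem parallelTransport_spec (hγ : ContMDiff 𝓘(ℝ, ℝ) 𝓘(ℝ, E) ∞ γ) (a : ℝ)
    (w : TangentSpace 𝓘(ℝ, E) (γ a)) :
    ∃ V : ∀ t, TangentSpace 𝓘(ℝ, E) (γ t), V a = w ∧ (∀ t, IsParallelAt γ V t) ∧
      ∀ b, parallelTransport γ a b w = V b := by
  have h : ∃ V : ∀ t, TangentSpace 𝓘(ℝ, E) (γ t), IsParallel γ V ∧ V a = w := by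
    obtain ⟨V, hV, hpar⟩ := exists_forall_isParallelAt hγ a w
    exact ⟨V, (isParallel_iff_forall_isParallelAt hγ).2 hpar, hV⟩
  refine ⟨h.choose, h.choose_spec.2,
    (isParallel_iff_forall_isParallelAt hγ).1 h.choose_spec.1, fun b => ?_⟩
  rw [parallelTransport, dif_pos h]

/-- Uniqueness removes the choice from the definition: any parallel field computes the transport.
Linearity and inversion follow from this. -/
theorem parallelTransport_eq (hγ : ContMDiff 𝓘(ℝ, ℝ) 𝓘(ℝ, E) ∞ γ)
    (hV : ∀ t, IsParallelAt γ V t) (a b : ℝ) : parallelTransport γ a b (V a) = V b := by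
  obtain ⟨W, hWa, hW, hT⟩ := parallelTransport_spec hγ a (V a)
  rw [hT b]
  exact eq_of_isParallelAt hγ isOpen_univ ordConnected_univ (fun t _ => hW t) (fun t _ => hV t)
    (mem_univ a) (mem_univ b) hWa

theorem inner_parallelTransport (hγ : ContMDiff 𝓘(ℝ, ℝ) 𝓘(ℝ, E) ∞ γ) (a b : ℝ)
    (v w : TangentSpace 𝓘(ℝ, E) (γ a)) :
    inner ℝ (parallelTransport γ a b v) (parallelTransport γ a b w) = inner ℝ v w := by
  obtain ⟨V, hVa, hV, hVT⟩ := parallelTransport_spec hγ a v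
  obtain ⟨W, hWa, hW, hWT⟩ := parallelTransport_spec hγ a w
  rw [hVT, hWT, ← hVa, ← hWa]
  exact inner_eq_of_isParallelAt hγ isOpen_univ ordConnected_univ (fun t _ => hV t)
    (fun t _ => hW t) (mem_univ b) (mem_univ a)

theorem parallelTransport_add (hγ : ContMDiff 𝓘(ℝ, ℝ) 𝓘(ℝ, E) ∞ γ) (a b : ℝ)
    (v w : TangentSpace 𝓘(ℝ, E) (γ a)) :
    parallelTransport γ a b (v + w) = parallelTransport γ a b v + parallelTransport γ a b w := by
  obtain ⟨V, hVa, hV, hVT⟩ := parallelTransport_spec hγ a v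
  obtain ⟨W, hWa, hW, hWT⟩ := parallelTransport_spec hγ a w
  rw [hVT, hWT, ← hVa, ← hWa]
  exact parallelTransport_eq hγ (fun t => (hV t).add (hW t)) a b

theorem parallelTransport_smul (hγ : ContMDiff 𝓘(ℝ, ℝ) 𝓘(ℝ, E) ∞ γ) (a b r : ℝ)
    (v : TangentSpace 𝓘(ℝ, E) (γ a)) :
    parallelTransport γ a b (r • v) = r • parallelTransport γ a b v := by
  obtain ⟨V, hVa, hV, hVT⟩ := parallelTransport_spec hγ a v
  rw [hVT, ← hVa]
  exact parallelTransport_eq hγ (fun t => (hV t).const_smul r) a b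

theorem parallelTransport_parallelTransport (hγ : ContMDiff 𝓘(ℝ, ℝ) 𝓘(ℝ, E) ∞ γ) (a b : ℝ)
    (v : TangentSpace 𝓘(ℝ, E) (γ a)) :
    parallelTransport γ b a (parallelTransport γ a b v) = v := by
  obtain ⟨V, hVa, hV, hVT⟩ := parallelTransport_spec hγ a v
  rw [hVT, parallelTransport_eq hγ hV, hVa]

/-- Parallel transport along a smooth curve, as a linear isometry. -/
def parallelTransportₗᵢ (hγ : ContMDiff 𝓘(ℝ, ℝ) 𝓘(ℝ, E) ∞ γ) (a b : ℝ) :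
    TangentSpace 𝓘(ℝ, E) (γ a) →ₗᵢ[ℝ] TangentSpace 𝓘(ℝ, E) (γ b) where
  toFun := parallelTransport γ a b
  map_add' := parallelTransport_add hγ a b
  map_smul' := parallelTransport_smul hγ a b
  norm_map' v := by
    have h := inner_parallelTransport hγ a b v v
    rw [real_inner_self_eq_norm_sq, real_inner_self_eq_norm_sq] at h
    exact (sq_eq_sq₀ (norm_nonneg _) (norm_nonneg _)).1 h

end ExistenceOfParallelFields

end

end RMarina

namespace RMarina

noncomputable section

/-! ### Differentials and gradients of the averaged objective. -/

section Objective

variable {E : Type*} [NormedAddCommGroup E] [NormedSpace ℝ E]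
  {M : Type*} [TopologicalSpace M] [ChartedSpace E M]

theorem hasMFDerivAt_objective {n : ℕ} {f : Fin n → M → ℝ}
    (hf : ∀ i, MDifferentiable 𝓘(ℝ, E) 𝓘(ℝ, ℝ) (f i)) (x : M) :
    HasMFDerivAt 𝓘(ℝ, E) 𝓘(ℝ, ℝ) (objective f) x ((1 / (n : ℝ)) •
      ∑ i, (mfderiv 𝓘(ℝ, E) 𝓘(ℝ, ℝ) (f i) x : TangentSpace 𝓘(ℝ, E) x →L[ℝ] ℝ)) := by
  have h1 : HasMFDerivAt 𝓘(ℝ, E) 𝓘(ℝ, ℝ) (∑ i, f i) x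
      (∑ i, (mfderiv 𝓘(ℝ, E) 𝓘(ℝ, ℝ) (f i) x : TangentSpace 𝓘(ℝ, E) x →L[ℝ] ℝ)) :=
    HasMFDerivAt.sum fun i _ => (hf i x).hasMFDerivAt
  have h3 : objective f = (1 / (n : ℝ)) • ∑ i, f i := by
    funext y
    simp [objective]
  rw [h3]
  exact h1.const_smul (1 / (n : ℝ))

theorem mdifferentiable_objective {n : ℕ} {f : Fin n → M → ℝ}
    (hf : ∀ i, MDifferentiable 𝓘(ℝ, E) 𝓘(ℝ, ℝ) (f i)) :
    MDifferentiable 𝓘(ℝ, E) 𝓘(ℝ, ℝ) (objective f) :=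
  fun x => (hasMFDerivAt_objective hf x).mdifferentiableAt

end Objective

section Gradients

variable {E : Type*} [NormedAddCommGroup E] [NormedSpace ℝ E] [FiniteDimensional ℝ E]
  {M : Type*} [TopologicalSpace M] [ChartedSpace E M]
  [RiemannianBundle (fun x : M => TangentSpace 𝓘(ℝ, E) x)]

theorem inner_riemGrad (f : M → ℝ) (x : M) (v : TangentSpace 𝓘(ℝ, E) x) :
    inner ℝ (riemGrad f x) v = mfderiv 𝓘(ℝ, E) 𝓘(ℝ, ℝ) f x v := by
  have : FiniteDimensional ℝ (TangentSpace 𝓘(ℝ, E) x) := inferInstanceAs (FiniteDimensional ℝ E)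
  have : CompleteSpace (TangentSpace 𝓘(ℝ, E) x) := FiniteDimensional.complete ℝ _
  unfold riemGrad
  exact InnerProductSpace.toDual_symm_apply

theorem riemGrad_objective {n : ℕ} {f : Fin n → M → ℝ}
    (hf : ∀ i, MDifferentiable 𝓘(ℝ, E) 𝓘(ℝ, ℝ) (f i)) (x : M) :
    riemGrad (E := E) (objective f) x = (1 / (n : ℝ)) • ∑ i, riemGrad (f i) x := by
  refine ext_inner_right ℝ fun v => ?_
  rw [inner_riemGrad, inner_smul_left, sum_inner]
  simp only [inner_riemGrad]
  rw [(hasMFDerivAt_objective hf x).mfderiv]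
  let A : Fin n → TangentSpace 𝓘(ℝ, E) x →L[ℝ] ℝ := fun i => mfderiv 𝓘(ℝ, E) 𝓘(ℝ, ℝ) (f i) x
  change (1 / (n : ℝ)) * (∑ i, A i) v = (1 / (n : ℝ)) * ∑ i, A i v
  rw [sum_apply]

end Gradients

/-! ### Geodesics and the descent inequality. -/

section Geodesics

open Set

variable {E : Type*} [NormedAddCommGroup E] [NormedSpace ℝ E]
  {M : Type*} [TopologicalSpace M] [ChartedSpace E M]

theorem velocity_comp_mul {γ : ℝ → M} (hγ : MDifferentiable 𝓘(ℝ, ℝ) 𝓘(ℝ, E) γ) (τ s : ℝ) :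
    velocity (E := E) (fun s => γ (τ * s)) s = τ • velocity γ (τ * s) := by
  have h1 : HasMFDerivAt 𝓘(ℝ, ℝ) 𝓘(ℝ, ℝ) (fun s : ℝ => τ * s) s
      (τ • ContinuousLinearMap.id ℝ ℝ) :=
    ((hasFDerivAt_id (𝕜 := ℝ) s).const_mul τ).hasMFDerivAt
  have h2 := HasMFDerivAt.comp s (hγ (τ * s)).hasMFDerivAt h1
  have h3 : velocity (E := E) (fun s => γ (τ * s)) s
      = mfderiv 𝓘(ℝ, ℝ) 𝓘(ℝ, E) γ (τ * s) (τ • (1 : ℝ)) := by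
    unfold velocity
    exact congrArg (fun A => A (1 : ℝ)) h2.mfderiv
  rw [h3]
  exact map_smul _ _ _

theorem hasDerivAt_comp_curve {f : M → ℝ} (hf : MDifferentiable 𝓘(ℝ, E) 𝓘(ℝ, ℝ) f) {γ : ℝ → M}
    (hγ : MDifferentiable 𝓘(ℝ, ℝ) 𝓘(ℝ, E) γ) (t : ℝ) :
    HasDerivAt (fun s => f (γ s)) (mfderiv 𝓘(ℝ, E) 𝓘(ℝ, ℝ) f (γ t) (velocity γ t) : ℝ) t := by
  let A : ℝ →L[ℝ] ℝ :=
    (mfderiv 𝓘(ℝ, E) 𝓘(ℝ, ℝ) f (γ t)).comp (mfderiv 𝓘(ℝ, ℝ) 𝓘(ℝ, E) γ t)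
  have h : HasFDerivAt (fun s => f (γ s)) A t :=
    (HasMFDerivAt.comp t (hf (γ t)).hasMFDerivAt (hγ t).hasMFDerivAt).hasFDerivAt
  exact h.hasDerivAt

theorem isGeodesicFrom_geod
    [RiemannianBundle (fun x : M => TangentSpace 𝓘(ℝ, E) x)] (hM : GeodesicallyComplete E M) (x : M) (v : TangentSpace 𝓘(ℝ, E) x) :
    IsGeodesicFrom x v (geod x v) := by
  unfold geod
  rw [dif_pos (hM x v)]
  exact (hM x v).choose_spec

/-- The identification of the tangent spaces at two equal points. -/
def tangentCast [RiemannianBundle (fun x : M => TangentSpace 𝓘(ℝ, E) x)] {x y : M} (h : y = x) :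
    TangentSpace 𝓘(ℝ, E) x →ₗᵢ[ℝ] TangentSpace 𝓘(ℝ, E) y where
  toFun w := h.symm ▸ w
  map_add' v w := by subst h; rfl
  map_smul' a v := by subst h; rfl
  norm_map' v := by subst h; rfl

/-- The geodesic from `x` satisfies γ(0) = x only propositionally, so gradients, norms and inner
products have to be carried across that equality. -/
theorem tangentCast_riemGrad [FiniteDimensional ℝ E]
    [RiemannianBundle (fun x : M => TangentSpace 𝓘(ℝ, E) x)] {x y : M} (h : y = x) (f : M → ℝ) {u : TangentSpace 𝓘(ℝ, E) y}
    {v : TangentSpace 𝓘(ℝ, E) x} (huv : (⟨y, u⟩ : TangentBundle 𝓘(ℝ, E) M) = ⟨x, v⟩) :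
    inner ℝ (riemGrad f y) u = inner ℝ (riemGrad f x) v ∧ ‖u‖ = ‖v‖ ∧
      tangentCast h (riemGrad (E := E) f x) = riemGrad f y := by
  subst h
  obtain rfl : u = v := by simpa using huv
  exact ⟨rfl, rfl, rfl⟩

variable [FiniteDimensional ℝ E] [IsManifold 𝓘(ℝ, E) ∞ M]
  [RiemannianBundle (fun x : M => TangentSpace 𝓘(ℝ, E) x)]
  [IsContMDiffRiemannianBundle 𝓘(ℝ, E) ∞ E (fun x : M => TangentSpace 𝓘(ℝ, E) x)]

/-- Affine reparametrizations of geodesics are geodesics. -/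
theorem IsGeodesic.comp_mul {γ : ℝ → M} (hγ : IsGeodesic (E := E) γ) (τ : ℝ) :
    IsGeodesic (E := E) (fun s => γ (τ * s)) := by
  have hsm := hγ.contMDiff
  have hmd := hsm.mdifferentiable (by simp)
  have hsm' : ContMDiff 𝓘(ℝ, ℝ) 𝓘(ℝ, E) ∞ (fun s => γ (τ * s)) :=
    hsm.comp (contDiff_const.mul contDiff_id).contMDiff
  refine ⟨hsm', (isParallel_iff_forall_isParallelAt hsm').2 fun s x₀ hx => ?_⟩
  obtain ⟨hd, heq⟩ := (isParallel_iff_forall_isParallelAt hsm).1 hγ.parallel_velocity (τ * s) x₀ hx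
  have hmul : HasDerivAt (fun s : ℝ => τ * s) τ s := by
    simpa using (hasDerivAt_id s).const_mul τ
  have hcoord : coordField x₀ (fun s => γ (τ * s)) (velocity (E := E) fun s => γ (τ * s))
      = fun s => τ • coordField x₀ γ (velocity γ) (τ * s) := by
    funext s
    unfold coordField
    rw [velocity_comp_mul hmd]
    exact map_smul _ _ _
  have h1 : HasDerivAt (fun s => τ • coordField x₀ γ (velocity γ) (τ * s))
      (τ • τ • deriv (coordField x₀ γ (velocity γ)) (τ * s)) s :=
    (HasDerivAt.scomp s hd.hasDerivAt hmul).fun_const_smul τ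
  have hc : HasDerivAt (fun s => extChartAt 𝓘(ℝ, E) x₀ (γ (τ * s)))
      (τ • deriv (fun s => extChartAt 𝓘(ℝ, E) x₀ (γ s)) (τ * s)) s :=
    HasDerivAt.scomp s ((contDiffAt_chart_comp hsm hx).differentiableAt (by simp)).hasDerivAt hmul
  rw [IsParallelInChart, hcoord]
  refine ⟨h1.differentiableAt, fun z => ?_⟩
  -- Both terms of the geodesic equation are homogeneous of degree two in the velocity, so τ²
  -- factors out.
  rw [h1.deriv, hc.deriv]
  have h3 := heq z
  rw [christoffelForm_smul_smul]
  simp only [map_smul, smul_apply, smul_eq_mul]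
  rw [← mul_add, ← mul_add, h3, mul_zero, mul_zero]

/-- The inner product of the gradient with the velocity grows at most linearly along geodesics. -/
theorem IsGSmooth.inner_velocity_le {L : ℝ} {f : M → ℝ} (hf : IsGSmooth E L f) {γ : ℝ → M}
    (hγ : IsGeodesic (E := E) γ) :
    inner ℝ (riemGrad f (γ 1)) (velocity (E := E) γ 1)
      ≤ inner ℝ (riemGrad f (γ 0)) (velocity (E := E) γ 0) + L * ‖velocity (E := E) γ 0‖ ^ 2 := by
  have hpar := (isParallel_iff_forall_isParallelAt hγ.contMDiff).1 hγ.parallel_velocity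
  have h1 := inner_parallelTransport hγ.contMDiff 1 0 (riemGrad (E := E) f (γ 1)) (velocity γ 1)
  -- The velocity of a geodesic is itself parallel, so transporting γ'(1) back gives γ'(0).
  rw [parallelTransport_eq hγ.contMDiff hpar] at h1
  have h2 := hf.lipschitz γ hγ
  have h3 := real_inner_le_norm (-(riemGrad (E := E) f (γ 0)
    - parallelTransport γ 1 0 (riemGrad f (γ 1)))) (velocity γ 0)
  rw [norm_neg] at h3
  rw [inner_neg_left, inner_sub_left, h1] at h3
  have h4 := mul_le_mul_of_nonneg_right h2 (norm_nonneg (velocity (E := E) γ 0))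
  nlinarith

/-- The descent inequality along a geodesic. -/
theorem IsGSmooth.le_along_geodesic {L : ℝ} {f : M → ℝ} (hf : IsGSmooth E L f)
    {γ : ℝ → M} (hγ : IsGeodesic (E := E) γ) :
    f (γ 1) ≤ f (γ 0) + inner ℝ (riemGrad f (γ 0)) (velocity (E := E) γ 0)
      + L / 2 * ‖velocity (E := E) γ 0‖ ^ 2 := by
  have hmd := hγ.contMDiff.mdifferentiable (by simp)
  set a : ℝ := inner ℝ (riemGrad f (γ 0)) (velocity (E := E) γ 0) with ha
  set N : ℝ := ‖velocity (E := E) γ 0‖ with hN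
  have hderiv : ∀ t, HasDerivAt (fun s => f (γ s))
      (inner ℝ (riemGrad f (γ t)) (velocity (E := E) γ t)) t := by
    intro t
    rw [inner_riemGrad]
    exact hasDerivAt_comp_curve hf.mdifferentiable hmd t
  have hbound : ∀ t, 0 < t →
      inner ℝ (riemGrad f (γ t)) (velocity (E := E) γ t) ≤ a + L * N ^ 2 * t := by
    intro t ht
    -- The geodesic s ↦ γ(ts) has initial speed tN; dividing its inequality by t > 0 gives a bound
    -- affine in t.
    have h := hf.inner_velocity_le (hγ.comp_mul t)
    rw [velocity_comp_mul hmd, velocity_comp_mul hmd, norm_smul, inner_smul_right,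
      inner_smul_right, mul_one, mul_zero, mul_pow, Real.norm_eq_abs, sq_abs] at h
    change t * _ ≤ t * a + L * (t ^ 2 * N ^ 2) at h
    refine le_of_mul_le_mul_left (h.trans (le_of_eq ?_)) ht
    ring
  -- The subtracted polynomial has derivative a + LN²t, which dominates (f ∘ γ)'. Monotonicity of ψ
  -- replaces integration, so integrability of the derivative is not needed.
  set ψ : ℝ → ℝ := fun t => f (γ t) - (a * t + L * N ^ 2 / 2 * t ^ 2) with hψ
  have hψd : ∀ t, HasDerivAt ψ
      (inner ℝ (riemGrad f (γ t)) (velocity (E := E) γ t) - (a + L * N ^ 2 * t)) t := by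
    intro t
    refine (hderiv t).sub ?_
    have h1 := ((hasDerivAt_id t).const_mul a).add
      (((hasDerivAt_id t).pow 2).const_mul (L * N ^ 2 / 2))
    refine (h1.congr_deriv ?_)
    simp
    ring
  have hanti : AntitoneOn ψ (Icc 0 1) := by
    refine antitoneOn_of_deriv_nonpos (convex_Icc 0 1)
      (fun t _ => (hψd t).continuousAt.continuousWithinAt)
      (fun t _ => (hψd t).differentiableAt.differentiableWithinAt) fun t ht => ?_
    rw [interior_Icc] at ht
    rw [(hψd t).deriv]
    linarith [hbound t ht.1]
  have h := hanti (left_mem_Icc.2 zero_le_one) (right_mem_Icc.2 zero_le_one) zero_le_one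
  simp only [hψ] at h
  linarith

/-- The transport to `Exp_x(v)` is a linear isometry, under which the gradients of geodesically
smooth functions are Lipschitz, and such functions satisfy the descent inequality. -/
theorem exists_expTransport_linearIsometry (hM : GeodesicallyComplete E M) (x : M)
    (v : TangentSpace 𝓘(ℝ, E) x) :
    ∃ T : TangentSpace 𝓘(ℝ, E) x →ₗᵢ[ℝ] TangentSpace 𝓘(ℝ, E) (riemExp x v),
      (∀ w, expTransport x v w = T w) ∧
      ∀ (L : ℝ) (f : M → ℝ), IsGSmooth E L f →
        ‖riemGrad f (riemExp x v) - T (riemGrad f x)‖ ≤ L * ‖v‖ ∧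
        f (riemExp x v) ≤ f x + inner ℝ (riemGrad f x) v + L / 2 * ‖v‖ ^ 2 := by
  obtain ⟨hgeo, hinit⟩ := isGeodesicFrom_geod hM x v
  refine ⟨(parallelTransportₗᵢ hgeo.contMDiff 0 1).comp (tangentCast (geod_zero x v)),
    fun w => rfl, fun L f hf => ?_⟩
  obtain ⟨h1, h2, h3⟩ := tangentCast_riemGrad (geod_zero x v) f hinit
  constructor
  · have h4 := hf.lipschitz _ hgeo
    rw [h2] at h4
    refine le_trans (le_of_eq ?_) h4
    change ‖riemGrad f (geod x v 1) - parallelTransportₗᵢ hgeo.contMDiff 0 1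
      (tangentCast (geod_zero x v) (riemGrad f x))‖ = _
    rw [h3]
    -- The smoothness hypothesis compares gradients at the start of the geodesic; the forward
    -- isometry moves the comparison to its end without changing the norm.
    have h5 := (parallelTransportₗᵢ hgeo.contMDiff 0 1).norm_map (riemGrad (E := E) f (geod x v 0)
      - parallelTransport (geod x v) 1 0 (riemGrad f (geod x v 1)))
    rw [← h5, map_sub, norm_sub_rev]
    congr 2
    exact (parallelTransport_parallelTransport hgeo.contMDiff 1 0 _).symm
  · have h4 := hf.le_along_geodesic hgeo
    rw [h1, h2] at h4
    rwa [geod_zero] at h4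

end Geodesics

end

end RMarina

namespace RMarina

noncomputable section

/-! ### Borel measurability on the tangent bundle. -/

section Measurability

open Topology Set

variable {E : Type*} [NormedAddCommGroup E] [NormedSpace ℝ E]
  {M : Type*} [TopologicalSpace M] [ChartedSpace E M]

omit [NormedSpace ℝ E] in
/-- Measurability is a local property, in charts of a second countable manifold. -/
theorem measurable_of_forall_chart_restrict [SecondCountableTopology M] {X : Type*}
    [TopologicalSpace X] [MeasurableSpace X] [BorelSpace X] {pr : X → M} (hpr : Continuous pr)
    {g : X → ℝ} (hg : ∀ x₀ : M, Measurable ((pr ⁻¹' (chartAt E x₀).source).domRestrict g)) :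
    Measurable g := by
  obtain ⟨s, hs, hcover⟩ := TopologicalSpace.countable_cover_nhds
    (f := fun x₀ : M => (chartAt E x₀).source) fun x => chart_source_mem_nhds E x
  intro B hB
  have h : g ⁻¹' B = ⋃ x₀ ∈ s, Subtype.val ''
      (((pr ⁻¹' (chartAt E x₀).source).domRestrict g) ⁻¹' B) := by
    ext q
    simp only [mem_iUnion, mem_image, mem_preimage, Subtype.exists, domRestrict_apply]
    constructor
    · intro hq
      have : pr q ∈ ⋃ x₀ ∈ s, (chartAt E x₀).source := hcover ▸ mem_univ _
      simp only [mem_iUnion] at this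
      obtain ⟨x₀, hx₀, hmem⟩ := this
      exact ⟨x₀, hx₀, q, hmem, hq, rfl⟩
    · rintro ⟨x₀, hx₀, q', hmem, hq', rfl⟩
      exact hq'
  rw [h]
  exact MeasurableSet.biUnion hs fun x₀ _ =>
    (((chartAt E x₀).open_source.preimage hpr).measurableSet).subtype_image (hg x₀ hB)

variable [IsManifold 𝓘(ℝ, E) ∞ M]

/-- This trades a differential whose domain varies with the point for a Fréchet derivative on the
fixed space `E`, where measurability can be stated. -/
theorem mfderiv_eq_fderiv_chart {f : M → ℝ} (hf : MDifferentiable 𝓘(ℝ, E) 𝓘(ℝ, ℝ) f) {x₀ x : M}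
    (hx : x ∈ (chartAt E x₀).source) (v : TangentSpace 𝓘(ℝ, E) x) :
    (mfderiv 𝓘(ℝ, E) 𝓘(ℝ, ℝ) f x v : ℝ)
      = fderiv ℝ (fun y => f ((extChartAt 𝓘(ℝ, E) x₀).symm y)) (extChartAt 𝓘(ℝ, E) x₀ x)
          (mfderiv 𝓘(ℝ, E) 𝓘(ℝ, E) (extChartAt 𝓘(ℝ, E) x₀) x v) := by
  have hev : f =ᶠ[𝓝 x]
      (fun y => f ((extChartAt 𝓘(ℝ, E) x₀).symm y)) ∘ (extChartAt 𝓘(ℝ, E) x₀) := by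
    filter_upwards [(chartAt E x₀).open_source.mem_nhds hx] with x' hx'
    simp only [Function.comp, chart_left_inv hx']
  have hd : MDifferentiableAt 𝓘(ℝ, E) 𝓘(ℝ, ℝ)
      (fun y => f ((extChartAt 𝓘(ℝ, E) x₀).symm y)) (extChartAt 𝓘(ℝ, E) x₀ x) :=
    MDifferentiableAt.comp _ (hf _) (mdifferentiableAt_chart_symm (chart_mem_target hx))
  have h := mfderiv_comp x hd (mdifferentiableAt_chart hx)
  have h2 : mfderiv 𝓘(ℝ, E) 𝓘(ℝ, ℝ) f x = mfderiv 𝓘(ℝ, E) 𝓘(ℝ, ℝ)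
      ((fun y => f ((extChartAt 𝓘(ℝ, E) x₀).symm y)) ∘ (extChartAt 𝓘(ℝ, E) x₀)) x :=
    hev.mfderiv_eq
  have h3 := congrArg (fun A => A v) (h2.trans h)
  rw [mfderiv_eq_fderiv] at h3
  exact h3

omit [IsManifold 𝓘(ℝ, E) ∞ M] in
/-- The coordinates of a tangent vector in the chart around `x₀`. -/
def vectorCoord (x₀ : M) (q : TangentBundle 𝓘(ℝ, E) M) : E :=
  mfderiv 𝓘(ℝ, E) 𝓘(ℝ, E) (extChartAt 𝓘(ℝ, E) x₀) q.proj q.2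

/-- The chart derivative on a fibre is the second component of the tangent bundle trivialization. -/
theorem continuous_restrict_vectorCoord (x₀ : M) :
    Continuous ((TotalSpace.proj ⁻¹' (chartAt E x₀).source).domRestrict
      (vectorCoord (E := E) x₀)) := by
  have : IsManifold 𝓘(ℝ, E) 1 M := IsManifold.of_le (n := ∞) (by simp)
  rw [← continuousOn_iff_continuous_domRestrict]
  have h : ContinuousOn (fun q : TangentBundle 𝓘(ℝ, E) M =>
      (trivializationAt E (TangentSpace 𝓘(ℝ, E)) x₀ q).2)
      (TotalSpace.proj ⁻¹' (chartAt E x₀).source) := by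
    refine continuous_snd.comp_continuousOn
      ((trivializationAt E (TangentSpace 𝓘(ℝ, E)) x₀).continuousOn.mono fun q hq => ?_)
    rw [Trivialization.mem_source]
    simpa using hq
  refine h.congr fun q hq => ?_
  have h2 := TangentBundle.continuousLinearMapAt_trivializationAt (I := 𝓘(ℝ, E)) (x₀ := x₀)
    (x := q.proj) hq
  have hq' : q.proj ∈ (trivializationAt E (TangentSpace 𝓘(ℝ, E)) x₀).baseSet := by simpa using hq
  have h3 := congrArg (fun A => A q.2) h2
  refine h3.symm.trans ?_
  rw [Trivialization.continuousLinearMapAt_apply,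
    Trivialization.coe_linearMapAt_of_mem _ hq']

theorem continuous_restrict_chart (x₀ : M) :
    Continuous ((TotalSpace.proj ⁻¹' (chartAt E x₀).source).domRestrict
      (fun q : TangentBundle 𝓘(ℝ, E) M => extChartAt 𝓘(ℝ, E) x₀ q.proj)) := by
  have : IsManifold 𝓘(ℝ, E) 1 M := IsManifold.of_le (n := ∞) (by simp)
  rw [← continuousOn_iff_continuous_domRestrict]
  refine (continuousOn_extChartAt (I := 𝓘(ℝ, E)) x₀).comp
    (FiberBundle.continuous_proj E (TangentSpace 𝓘(ℝ, E))).continuousOn fun q hq => ?_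
  rw [extChartAt_source]
  exact hq

variable [FiniteDimensional ℝ E] [SecondCountableTopology M]

/-- In a chart, a Fréchet derivative is evaluated at continuous coordinates. The Fréchet derivative
is measurable without being continuous, so differentiability of `f` suffices. -/
theorem measurable_mfderiv_apply {f : M → ℝ} (hf : MDifferentiable 𝓘(ℝ, E) 𝓘(ℝ, ℝ) f) :
    Measurable[borel (TangentBundle 𝓘(ℝ, E) M)]
      (fun q : TangentBundle 𝓘(ℝ, E) M => (mfderiv 𝓘(ℝ, E) 𝓘(ℝ, ℝ) f q.proj q.2 : ℝ)) := by
  have : IsManifold 𝓘(ℝ, E) 1 M := IsManifold.of_le (n := ∞) (by simp)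
  borelize (TangentBundle 𝓘(ℝ, E) M)
  borelize E
  have : ProperSpace E := FiniteDimensional.proper ℝ E
  refine measurable_of_forall_chart_restrict (E := E) (M := M) (pr := TotalSpace.proj)
    (FiberBundle.continuous_proj E (TangentSpace 𝓘(ℝ, E))) fun x₀ => ?_
  have h1 := (measurable_fderiv ℝ (fun y => f ((extChartAt 𝓘(ℝ, E) x₀).symm y))).comp
    (continuous_restrict_chart (E := E) (M := M) x₀).measurable
  have h2 := (continuous_restrict_vectorCoord (E := E) x₀).measurable
  have h3 := (ContinuousLinearMap.measurable_apply₂ (𝕜 := ℝ) (E := E) (F := ℝ)).comp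
    (h1.prodMk h2)
  convert! h3 using 1
  funext q
  exact mfderiv_eq_fderiv_chart hf q.2 q.1.2

variable [RiemannianBundle (fun x : M => TangentSpace 𝓘(ℝ, E) x)]
  [IsContMDiffRiemannianBundle 𝓘(ℝ, E) ∞ E (fun x : M => TangentSpace 𝓘(ℝ, E) x)]

-- In coordinates the gradient is G⁻¹ df, so its squared norm is df(G⁻¹ df).
omit [SecondCountableTopology M]
  [IsContMDiffRiemannianBundle 𝓘(ℝ, E) ∞ E (fun x : M => TangentSpace 𝓘(ℝ, E) x)] in
theorem norm_riemGrad_sq_eq {f : M → ℝ} (hf : MDifferentiable 𝓘(ℝ, E) 𝓘(ℝ, ℝ) f) {x₀ x : M}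
    (hx : x ∈ (chartAt E x₀).source) :
    ‖riemGrad (E := E) f x‖ ^ 2
      = fderiv ℝ (fun y => f ((extChartAt 𝓘(ℝ, E) x₀).symm y)) (extChartAt 𝓘(ℝ, E) x₀ x)
        ((metricForm x₀ (extChartAt 𝓘(ℝ, E) x₀ x)).inverse
          (fderiv ℝ (fun y => f ((extChartAt 𝓘(ℝ, E) x₀).symm y)) (extChartAt 𝓘(ℝ, E) x₀ x))) := by
  have : IsManifold 𝓘(ℝ, E) 1 M := IsManifold.of_le (n := ∞) (by simp)
  have hinv := metricForm_isInvertible (chart_mem_target hx)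
  rw [← real_inner_self_eq_norm_sq, inner_riemGrad, mfderiv_eq_fderiv_chart hf hx]
  congr 1
  refine Eq.symm (hinv.inverse_apply_eq.2 ?_)
  ext u
  obtain ⟨w, rfl⟩ := (isInvertible_mfderiv_extChartAt (I := 𝓘(ℝ, E)) (x := x₀) (y := x)
    (by rwa [extChartAt_source])).surjective u
  refine (mfderiv_eq_fderiv_chart hf hx w).symm.trans ?_
  rw [← inner_riemGrad]
  exact (coordMetric_mfderiv hx _ _).symm

theorem measurable_norm_riemGrad_sq {f : M → ℝ} (hf : MDifferentiable 𝓘(ℝ, E) 𝓘(ℝ, ℝ) f) :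
    Measurable[borel (TangentBundle 𝓘(ℝ, E) M)]
      (fun q : TangentBundle 𝓘(ℝ, E) M => ‖riemGrad (E := E) f q.proj‖ ^ 2) := by
  have : IsManifold 𝓘(ℝ, E) 1 M := IsManifold.of_le (n := ∞) (by simp)
  borelize (TangentBundle 𝓘(ℝ, E) M)
  borelize E
  have : ProperSpace E := FiniteDimensional.proper ℝ E
  have : ProperSpace (E →L[ℝ] ℝ) := FiniteDimensional.proper ℝ _
  refine measurable_of_forall_chart_restrict (E := E) (M := M) (pr := TotalSpace.proj)
    (FiberBundle.continuous_proj E (TangentSpace 𝓘(ℝ, E))) fun x₀ => ?_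
  have h1 := (measurable_fderiv ℝ (fun y => f ((extChartAt 𝓘(ℝ, E) x₀).symm y))).comp
    (continuous_restrict_chart (E := E) (M := M) x₀).measurable
  have h2 : Continuous ((TotalSpace.proj ⁻¹' (chartAt E x₀).source).domRestrict
      (fun q : TangentBundle 𝓘(ℝ, E) M =>
        (metricForm (E := E) x₀ (extChartAt 𝓘(ℝ, E) x₀ q.proj)).inverse)) := by
    rw [continuous_iff_continuousAt]
    intro q
    have hy := chart_mem_target (E := E) q.2
    have h3 : ContinuousAt (fun y => (metricForm (E := E) x₀ y).inverse)
        (extChartAt 𝓘(ℝ, E) x₀ q.1.proj) :=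
      ContinuousAt.comp (f := metricForm (E := E) x₀)
        ((metricForm_isInvertible hy).contDiffAt_map_inverse (n := 0)).continuousAt
        (contDiffAt_metricForm hy).continuousAt
    exact ContinuousAt.comp (f := (TotalSpace.proj ⁻¹' (chartAt E x₀).source).domRestrict
      (fun q : TangentBundle 𝓘(ℝ, E) M => extChartAt 𝓘(ℝ, E) x₀ q.proj)) h3
      (continuous_restrict_chart (E := E) (M := M) x₀).continuousAt
  have h4 := (ContinuousLinearMap.measurable_apply₂ (𝕜 := ℝ) (E := E →L[ℝ] ℝ) (F := E)).comp
    (h2.measurable.prodMk h1)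
  have h5 := (ContinuousLinearMap.measurable_apply₂ (𝕜 := ℝ) (E := E) (F := ℝ)).comp
    (h1.prodMk h4)
  convert! h5 using 1
  funext q
  exact norm_riemGrad_sq_eq hf q.2

omit [FiniteDimensional ℝ E] [SecondCountableTopology M] in
theorem continuous_norm_sq_tangentBundle :
    Continuous (fun q : TangentBundle 𝓘(ℝ, E) M => ‖q.2‖ ^ 2) := by
  have : IsManifold 𝓘(ℝ, E) 1 M := IsManifold.of_le (n := ∞) (by simp)
  have : IsContMDiffRiemannianBundle 𝓘(ℝ, E) 0 E (fun x : M => TangentSpace 𝓘(ℝ, E) x) :=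
    IsContMDiffRiemannianBundle.of_le (n := ∞) (by simp)
  have : IsContinuousRiemannianBundle E (fun x : M => TangentSpace 𝓘(ℝ, E) x) := by
    obtain ⟨g, hg, h⟩ := IsContMDiffRiemannianBundle.exists_contMDiff (IB := 𝓘(ℝ, E)) (n := ∞)
      (F := E) (E := fun x : M => TangentSpace 𝓘(ℝ, E) x)
    exact ⟨g, hg.continuous, h⟩
  have h := Continuous.inner_bundle (F := E) (E := fun x : M => TangentSpace 𝓘(ℝ, E) x)
    (b := fun q : TangentBundle 𝓘(ℝ, E) M => q.proj) (v := fun q => q.2) (w := fun q => q.2)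
    continuous_id continuous_id
  simpa only [real_inner_self_eq_norm_sq] using h

/-- Expanding the square leaves ‖q‖² - 2 df(q) + ‖∇f‖², three scalar functions already treated; the
gradient never has to be measurable as a map into the bundle. -/
theorem measurable_norm_sub_riemGrad_sq {f : M → ℝ} (hf : MDifferentiable 𝓘(ℝ, E) 𝓘(ℝ, ℝ) f) :
    Measurable[borel (TangentBundle 𝓘(ℝ, E) M)]
      (fun q : TangentBundle 𝓘(ℝ, E) M => ‖q.2 - riemGrad (E := E) f q.proj‖ ^ 2) := by
  borelize (TangentBundle 𝓘(ℝ, E) M)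
  have h := ((continuous_norm_sq_tangentBundle (E := E) (M := M)).measurable.sub
    ((measurable_mfderiv_apply hf).const_mul 2)).add (measurable_norm_riemGrad_sq hf)
  convert! h using 1
  funext q
  rw [norm_sub_sq_real, real_inner_comm, inner_riemGrad]
  rfl

omit [FiniteDimensional ℝ E] [SecondCountableTopology M]
  [RiemannianBundle (fun x : M => TangentSpace 𝓘(ℝ, E) x)]
  [IsContMDiffRiemannianBundle 𝓘(ℝ, E) ∞ E (fun x : M => TangentSpace 𝓘(ℝ, E) x)] in
theorem measurable_comp_proj {f : M → ℝ} (hf : Continuous f) :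
    Measurable[borel (TangentBundle 𝓘(ℝ, E) M)]
      (fun q : TangentBundle 𝓘(ℝ, E) M => f q.proj) := by
  have : IsManifold 𝓘(ℝ, E) 1 M := IsManifold.of_le (n := ∞) (by simp)
  borelize (TangentBundle 𝓘(ℝ, E) M)
  exact (hf.comp (FiberBundle.continuous_proj E (TangentSpace 𝓘(ℝ, E)))).measurable

end Measurability

end

end RMarina

namespace RMarina

noncomputable section

/-! ### Second moments of sums of independent centered vectors. -/

section IndependentSums

variable {H : Type*} [NormedAddCommGroup H] [InnerProductSpace ℝ H]
  {ι : Type*} [Fintype ι] {S : Type*} [MeasurableSpace S] {ν : ι → Measure S}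
  [∀ i, IsProbabilityMeasure (ν i)] {X : ι → S → H}

theorem integrable_comp_eval_pi {F : Type*} [NormedAddCommGroup F] {g : S → F} (i : ι)
    (hg : Integrable g (ν i)) : Integrable (fun s : ι → S => g (s i)) (Measure.pi ν) :=
  (measurePreserving_eval ν i).integrable_comp_of_integrable hg

theorem integral_comp_eval_pi {F : Type*} [NormedAddCommGroup F] [NormedSpace ℝ F] {g : S → F}
    (i : ι) (hg : Integrable g (ν i)) : ∫ s : ι → S, g (s i) ∂(Measure.pi ν) = ∫ a, g a ∂(ν i) := by
  rw [← (measurePreserving_eval ν i).map_eq, integral_map (measurable_pi_apply i).aemeasurable]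
  rw [(measurePreserving_eval ν i).map_eq]
  exact hg.aestronglyMeasurable

theorem integrable_inner_of_sq {Ω : Type*} [MeasurableSpace Ω] {μ : Measure Ω} {Y Z : Ω → H}
    (hY : AEStronglyMeasurable Y μ) (hZ : AEStronglyMeasurable Z μ)
    (hY2 : Integrable (fun a => ‖Y a‖ ^ 2) μ) (hZ2 : Integrable (fun a => ‖Z a‖ ^ 2) μ) :
    Integrable (fun a => inner ℝ (Y a) (Z a)) μ := by
  refine Integrable.mono' (hY2.add hZ2) (hY.inner hZ) (Filter.Eventually.of_forall fun a => ?_)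
  refine (norm_inner_le_norm (Y a) (Z a)).trans ?_
  simp only [Pi.add_apply]
  nlinarith [sq_nonneg (‖Y a‖ - ‖Z a‖), sq_nonneg ‖Y a‖, sq_nonneg ‖Z a‖]

/-- The second moment of a constant plus a sum of independent centered random vectors. -/
theorem integral_norm_add_sum_sq [CompleteSpace H] (hX : ∀ i, Integrable (X i) (ν i))
    (hX0 : ∀ i, ∫ a, X i a ∂(ν i) = 0) (hX2 : ∀ i, Integrable (fun a => ‖X i a‖ ^ 2) (ν i))
    (A : H) :
    Integrable (fun s : ι → S => ‖A + ∑ i, X i (s i)‖ ^ 2) (Measure.pi ν) ∧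
    ∫ s : ι → S, ‖A + ∑ i, X i (s i)‖ ^ 2 ∂(Measure.pi ν)
      = ‖A‖ ^ 2 + ∑ i, ∫ a, ‖X i a‖ ^ 2 ∂(ν i) := by
  classical
  have hXi : ∀ i, Integrable (fun s : ι → S => X i (s i)) (Measure.pi ν) := fun i =>
    integrable_comp_eval_pi i (hX i)
  have hX2i : ∀ i, Integrable (fun s : ι → S => ‖X i (s i)‖ ^ 2) (Measure.pi ν) := fun i =>
    integrable_comp_eval_pi (g := fun a => ‖X i a‖ ^ 2) i (hX2 i)
  have hexp : ∀ s : ι → S, ‖A + ∑ i, X i (s i)‖ ^ 2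
      = ‖A‖ ^ 2 + ∑ i, 2 * inner ℝ A (X i (s i))
        + ∑ i, ∑ j, inner ℝ (X i (s i)) (X j (s j)) := by
    intro s
    rw [norm_add_sq_real, ← real_inner_self_eq_norm_sq (∑ i, X i (s i)), inner_sum, sum_inner,
      ← Finset.mul_sum]
    congr 1
    simp only [inner_sum]
  have hcross : ∀ i j, Integrable (fun s : ι → S => inner ℝ (X i (s i)) (X j (s j)))
      (Measure.pi ν) := fun i j =>
    integrable_inner_of_sq (hXi i).aestronglyMeasurable (hXi j).aestronglyMeasurable
      (hX2i i) (hX2i j)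
  have hlin : ∀ i, Integrable (fun s : ι → S => 2 * inner ℝ A (X i (s i))) (Measure.pi ν) :=
    fun i => ((hXi i).const_inner A).const_mul 2
  have hlin0 : ∀ i, ∫ s : ι → S, 2 * inner ℝ A (X i (s i)) ∂(Measure.pi ν) = 0 := by
    intro i
    rw [integral_const_mul, integral_inner (hXi i), integral_comp_eval_pi i (hX i), hX0 i,
      inner_zero_right, mul_zero]
  have hcross0 : ∀ i j, i ≠ j →
      ∫ s : ι → S, inner ℝ (X i (s i)) (X j (s j)) ∂(Measure.pi ν) = 0 := by
    intro i j hij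
    -- Independence is used for the coordinates s i, before `X` is applied, so `H` needs no
    -- σ-algebra.
    have hind : IndepFun (fun s : ι → S => s i) (fun s : ι → S => s j) (Measure.pi ν) :=
      (iIndepFun_pi (μ := ν) (X := fun _ a => a) fun i => aemeasurable_id).indepFun hij
    have h := hind.integral_bilin_comp_comp (𝕜 := ℝ) (f := X i) (g := X j)
      (measurable_pi_apply i).aemeasurable (measurable_pi_apply j).aemeasurable
      (by rw [(measurePreserving_eval ν i).map_eq]; exact hX i)
      (by rw [(measurePreserving_eval ν j).map_eq]; exact hX j) (innerSL ℝ)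
    refine h.trans ?_
    rw [integral_comp_eval_pi i (hX i), hX0 i, map_zero]
    rfl
  have hint2 : Integrable (fun s : ι → S => ∑ i, 2 * inner ℝ A (X i (s i))) (Measure.pi ν) :=
    integrable_finsetSum _ fun i _ => hlin i
  have hint3 : Integrable (fun s : ι → S => ∑ i, ∑ j, inner ℝ (X i (s i)) (X j (s j)))
      (Measure.pi ν) :=
    integrable_finsetSum _ fun i _ => integrable_finsetSum _ fun j _ => hcross i j
  simp only [hexp]
  refine ⟨((integrable_const _).add hint2).add hint3, ?_⟩
  have hint12 : Integrable (fun s : ι → S => ‖A‖ ^ 2 + ∑ i, 2 * inner ℝ A (X i (s i)))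
    (Measure.pi ν) := (integrable_const _).add hint2
  rw [integral_add hint12 hint3, integral_add (integrable_const _) hint2,
    integral_finsetSum _ fun i _ => hlin i,
    integral_finsetSum _ fun i _ => integrable_finsetSum _ fun j _ => hcross i j]
  simp only [hlin0, Finset.sum_const_zero, add_zero, integral_const, probReal_univ, one_smul]
  congr 1
  refine Finset.sum_congr rfl fun i _ => ?_
  rw [integral_finsetSum _ fun j _ => hcross i j, Finset.sum_eq_single i
    (fun j _ hj => hcross0 i j hj.symm) (fun h => absurd (Finset.mem_univ i) h)]
  simp only [real_inner_self_eq_norm_sq]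
  exact integral_comp_eval_pi (g := fun a => ‖X i a‖ ^ 2) i (hX2 i)

end IndependentSums

/-! ### The common coin. -/

section Coin

theorem lintegral_coinLaw {p : ℝ} (g : Bool → ENNReal) :
    ∫⁻ c, g c ∂(coinLaw p) = ENNReal.ofReal p * g true + ENNReal.ofReal (1 - p) * g false := by
  rw [coinLaw, lintegral_add_measure, lintegral_smul_measure, lintegral_smul_measure,
    lintegral_dirac, lintegral_dirac]
  rfl

theorem isProbabilityMeasure_coinLaw {p : ℝ} (hp0 : 0 ≤ p) (hp1 : p ≤ 1) :
    IsProbabilityMeasure (coinLaw p) := by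
  refine ⟨?_⟩
  rw [← lintegral_one, lintegral_coinLaw, mul_one, mul_one, ← ENNReal.ofReal_add hp0 (by linarith)]
  simp

end Coin

/-! ### Expected decrease of the Lyapunov function in one step. -/

section OneStep

/-- With a = √q Lη the hypothesis reads Lη + a ≤ 1; hence 0 ≤ a ≤ 1, so a² ≤ a. -/
theorem stepsize_quadratic_le {L η q : ℝ} (hL : 0 < L) (hη0 : 0 < η) (hq : 0 ≤ q)
    (hη : η ≤ 1 / (L * (1 + √q))) : L * η + q * (L * η) ^ 2 ≤ 1 := by
  have hs : 0 ≤ √q := Real.sqrt_nonneg q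
  have hsq : √q * √q = q := Real.mul_self_sqrt hq
  rw [le_div_iff₀ (by positivity)] at hη
  have hpos : 0 < L * η := by positivity
  have h1 : √q * (L * η) ≤ 1 := by nlinarith
  have h2 : √q * (L * η) * (√q * (L * η)) ≤ √q * (L * η) := by
    have : 0 ≤ √q * (L * η) := by positivity
    nlinarith
  have h3 : q * (L * η) ^ 2 = √q * (L * η) * (√q * (L * η)) := by
    rw [mul_mul_mul_comm, hsq, sq]
  nlinarith

variable {E : Type*} [NormedAddCommGroup E] [NormedSpace ℝ E] [FiniteDimensional ℝ E]
  {M : Type*} [TopologicalSpace M] [ChartedSpace E M] [IsManifold 𝓘(ℝ, E) ∞ M]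
  [RiemannianBundle (fun x : M => TangentSpace 𝓘(ℝ, E) x)]
  [IsContMDiffRiemannianBundle 𝓘(ℝ, E) ∞ E (fun x : M => TangentSpace 𝓘(ℝ, E) x)]

omit [IsManifold 𝓘(ℝ, E) ∞ M]
  [IsContMDiffRiemannianBundle 𝓘(ℝ, E) ∞ E (fun x : M => TangentSpace 𝓘(ℝ, E) x)] in
/-- The Lyapunov function of the algorithm, on pairs of a point and an aggregated estimator. -/
def potential {n : ℕ} (f : Fin n → M → ℝ) (fstar η p : ℝ) (q : TangentBundle 𝓘(ℝ, E) M) : ℝ :=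
  objective f q.proj - fstar + η / (2 * p) * ‖q.2 - riemGrad (E := E) (objective f) q.proj‖ ^ 2

omit [FiniteDimensional ℝ E] [IsManifold 𝓘(ℝ, E) ∞ M]
  [RiemannianBundle (fun x : M => TangentSpace 𝓘(ℝ, E) x)]
  [IsContMDiffRiemannianBundle 𝓘(ℝ, E) ∞ E (fun x : M => TangentSpace 𝓘(ℝ, E) x)] in
/-- The pair of the point and of the aggregated estimator. -/
def State.pair {n : ℕ} (σ : State E M n) : TangentBundle 𝓘(ℝ, E) M := ⟨σ.pt, σ.avg⟩

/-- The expected squared error of the compressed estimator after one step. -/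
theorem lintegral_error_compressed_le (hM : GeodesicallyComplete E M) {n : ℕ} (hn : 0 < n)
    {f : Fin n → M → ℝ} {L : ℝ} (hf : ∀ i, IsGSmooth E L (f i)) {S : Type*}
    [MeasurableSpace S] {ν : Fin n → Measure S} [∀ i, IsProbabilityMeasure (ν i)]
    {Q : Fin n → S → ∀ x : M, TangentSpace 𝓘(ℝ, E) x → TangentSpace 𝓘(ℝ, E) x}
    {ωQ : ℝ} (hQ : ∀ i, IsUnbiasedCompressor (ν i) (Q i) ωQ) (η : ℝ) (σ : State E M n) :
    ∫⁻ s, ENNReal.ofReal (‖(marinaStep f Q η σ false s).avg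
        - riemGrad (objective f) (marinaStep f Q η σ false s).pt‖ ^ 2) ∂(Measure.pi ν)
      ≤ ENNReal.ofReal (‖σ.avg - riemGrad (objective f) σ.pt‖ ^ 2
          + ωQ / n * (L * η) ^ 2 * ‖σ.avg‖ ^ 2) := by
  have hn' : (0 : ℝ) < n := by exact_mod_cast hn
  have hω : 0 ≤ ωQ := (hQ ⟨0, hn⟩).nonneg
  set y := riemExp σ.pt (-(η • σ.avg)) with hy
  obtain ⟨T, hT, hT'⟩ : ∃ T : TangentSpace 𝓘(ℝ, E) σ.pt →ₗᵢ[ℝ] TangentSpace 𝓘(ℝ, E) y, _ :=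
    exists_expTransport_linearIsometry hM σ.pt (-(η • σ.avg))
  have : FiniteDimensional ℝ (TangentSpace 𝓘(ℝ, E) y) := inferInstanceAs (FiniteDimensional ℝ E)
  have : CompleteSpace (TangentSpace 𝓘(ℝ, E) y) := FiniteDimensional.complete ℝ _
  set d : Fin n → TangentSpace 𝓘(ℝ, E) y := fun i => riemGrad (f i) y - T (riemGrad (f i) σ.pt)
    with hd
  have hdn : ∀ i, ‖d i‖ ≤ L * ‖η • σ.avg‖ := fun i => by
    have := (hT' L (f i) (hf i)).1
    rwa [norm_neg] at this
  set X : Fin n → S → TangentSpace 𝓘(ℝ, E) y := fun i a => (1 / (n : ℝ)) • (Q i a y (d i) - d i)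
    with hX
  have hfd : ∀ i, MDifferentiable 𝓘(ℝ, E) 𝓘(ℝ, ℝ) (f i) := fun i => (hf i).mdifferentiable
  -- Adding and subtracting the vectors `d i`, the new gradients cancel: what is left is the
  -- transported old error plus centered noise.
  have hkey : ∀ s : Fin n → S, (marinaStep f Q η σ false s).avg
      - riemGrad (objective f) (marinaStep f Q η σ false s).pt
      = T (σ.avg - riemGrad (objective f) σ.pt) + ∑ i, X i (s i) := by
    intro s
    have h1 : (marinaStep f Q η σ false s).avg
        = (1 / (n : ℝ)) • ∑ i, (T (σ.est i) + Q i (s i) y (d i)) := by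
      simp only [hd, ← hT]
      rfl
    have h2 : riemGrad (objective f) (marinaStep f Q η σ false s).pt
        = (1 / (n : ℝ)) • ∑ i, riemGrad (f i) y := riemGrad_objective hfd y
    refine (congrArg₂ (fun a b : TangentSpace 𝓘(ℝ, E) y => a - b) h1 h2).trans ?_
    rw [riemGrad_objective hfd σ.pt, State.avg, map_sub, map_smul, map_smul, map_sum,
      map_sum]
    simp only [hX, hd, ← Finset.smul_sum, Finset.sum_add_distrib, Finset.sum_sub_distrib]
    module
  have hX1 : ∀ i, Integrable (X i) (ν i) := fun i =>
    (((hQ i).integrable y (d i)).sub (integrable_const _)).smul (1 / (n : ℝ))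
  have hX0 : ∀ i, ∫ a, X i a ∂(ν i) = 0 := by
    intro i
    simp only [hX]
    rw [integral_smul, integral_sub ((hQ i).integrable y (d i)) (integrable_const _),
      (hQ i).unbiased y (d i)]
    simp
  have hXsq : ∀ i, (fun a => ‖X i a‖ ^ 2)
      = fun a => (1 / (n : ℝ)) ^ 2 * ‖Q i a y (d i) - d i‖ ^ 2 := by
    intro i
    funext a
    simp only [hX]
    rw [norm_smul, mul_pow, Real.norm_of_nonneg (by positivity)]
  have hX2 : ∀ i, Integrable (fun a => ‖X i a‖ ^ 2) (ν i) := fun i => by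
    rw [hXsq i]
    exact ((hQ i).integrable_sq y (d i)).const_mul _
  have hX2le : ∀ i, ∫ a, ‖X i a‖ ^ 2 ∂(ν i)
      ≤ (1 / (n : ℝ)) ^ 2 * (ωQ * (L * ‖η • σ.avg‖) ^ 2) := by
    intro i
    rw [hXsq i, integral_const_mul]
    refine mul_le_mul_of_nonneg_left (((hQ i).variance_le y (d i)).trans ?_) (by positivity)
    exact mul_le_mul_of_nonneg_left (pow_le_pow_left₀ (norm_nonneg _) (hdn i) 2) hω
  obtain ⟨hint, hval⟩ := integral_norm_add_sum_sq hX1 hX0 hX2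
    (T (σ.avg - riemGrad (objective f) σ.pt))
  calc ∫⁻ s, ENNReal.ofReal (‖(marinaStep f Q η σ false s).avg
        - riemGrad (objective f) (marinaStep f Q η σ false s).pt‖ ^ 2) ∂(Measure.pi ν)
      = ∫⁻ s : Fin n → S, ENNReal.ofReal (‖T (σ.avg - riemGrad (objective f) σ.pt)
          + ∑ i, X i (s i)‖ ^ 2) ∂(Measure.pi ν) :=
        lintegral_congr fun s => congrArg (fun w : TangentSpace 𝓘(ℝ, E) y =>
          ENNReal.ofReal (‖w‖ ^ 2)) (hkey s)
    _ = ENNReal.ofReal (∫ s : Fin n → S, ‖T (σ.avg - riemGrad (objective f) σ.pt)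
          + ∑ i, X i (s i)‖ ^ 2 ∂(Measure.pi ν)) :=
        (ofReal_integral_eq_lintegral_ofReal hint
          (Filter.Eventually.of_forall fun s => by positivity)).symm
    _ ≤ _ := by
        refine ENNReal.ofReal_le_ofReal ?_
        rw [hval, T.norm_map]
        -- The n variances each carry a factor 1/n², which leaves ω/n.
        refine add_le_add le_rfl ((Finset.sum_le_sum fun i _ => hX2le i).trans (le_of_eq ?_))
        rw [Finset.sum_const, Finset.card_univ, Fintype.card_fin, nsmul_eq_mul, norm_smul,
          Real.norm_eq_abs, mul_pow, mul_pow, mul_pow, sq_abs]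
        field_simp

/-- The objective decreases along one step, up to the error of the estimator. -/
theorem objective_step_le (hM : GeodesicallyComplete E M) {n : ℕ} (hn : 0 < n)
    {f : Fin n → M → ℝ} {L : ℝ} (hf : ∀ i, IsGSmooth E L (f i)) (η : ℝ) (x : M)
    (g : TangentSpace 𝓘(ℝ, E) x) :
    objective f (riemExp x (-(η • g))) ≤ objective f x
      - η / 2 * (‖riemGrad (E := E) (objective f) x‖ ^ 2 + ‖g‖ ^ 2 - ‖g - riemGrad (objective f) x‖ ^ 2)
      + L / 2 * η ^ 2 * ‖g‖ ^ 2 := by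
  have hn' : (n : ℝ) ≠ 0 := by exact_mod_cast hn.ne'
  obtain ⟨T, hT, hT'⟩ := exists_expTransport_linearIsometry hM x (-(η • g))
  have h1 : objective f (riemExp x (-(η • g))) ≤ (1 / (n : ℝ)) * ∑ i, (f i x
      + inner ℝ (riemGrad (f i) x) (-(η • g)) + L / 2 * ‖-(η • g)‖ ^ 2) := by
    unfold objective
    exact mul_le_mul_of_nonneg_left (Finset.sum_le_sum fun i _ => (hT' L (f i) (hf i)).2)
      (by positivity)
  refine h1.trans (le_of_eq ?_)
  have h2 : inner ℝ (riemGrad (E := E) (objective f) x) g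
      = (1 / (n : ℝ)) * ∑ i, inner ℝ (riemGrad (f i) x) g := by
    rw [riemGrad_objective (fun i => (hf i).mdifferentiable) x, real_inner_smul_left, sum_inner]
  -- Polarization, which turns -η⟨∇f, g⟩ into the three squared norms.
  have h3 : ‖g - riemGrad (objective f) x‖ ^ 2
      = ‖g‖ ^ 2 - 2 * inner ℝ (riemGrad (objective f) x) g
        + ‖riemGrad (E := E) (objective f) x‖ ^ 2 := by
    rw [norm_sub_sq_real, real_inner_comm]
  rw [h3, h2]
  simp only [inner_neg_right, inner_smul_right, norm_neg, norm_smul, Finset.sum_add_distrib,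
    Finset.sum_neg_distrib, ← Finset.mul_sum, Finset.sum_const, Finset.card_univ, Fintype.card_fin,
    nsmul_eq_mul, mul_pow, Real.norm_eq_abs, sq_abs]
  unfold objective
  field_simp
  ring

/-- The Lyapunov function decreases in expectation at each step. -/
theorem lintegral_potential_step_le (hM : GeodesicallyComplete E M) {n : ℕ} (hn : 0 < n)
    {f : Fin n → M → ℝ} {L : ℝ} (hL : 0 < L) (hf : ∀ i, IsGSmooth E L (f i))
    {fstar : ℝ} (hfstar : ∀ x, fstar ≤ objective f x) {S : Type*}
    [MeasurableSpace S] {ν : Fin n → Measure S} [∀ i, IsProbabilityMeasure (ν i)]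
    {Q : Fin n → S → ∀ x : M, TangentSpace 𝓘(ℝ, E) x → TangentSpace 𝓘(ℝ, E) x}
    {ωQ : ℝ} (hQ : ∀ i, IsUnbiasedCompressor (ν i) (Q i) ωQ)
    {p : ℝ} (hp0 : 0 < p) (hp1 : p ≤ 1) {η : ℝ} (hη0 : 0 < η)
    (hη : η ≤ 1 / (L * (1 + √((1 - p) / p * (ωQ / n))))) (σ : State E M n) :
    ∫⁻ r, ENNReal.ofReal (potential f fstar η p (marinaStep f Q η σ r.1 r.2).pair)
        ∂((coinLaw p).prod (Measure.pi ν))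
      + ENNReal.ofReal (η / 2 * ‖riemGrad (E := E) (objective f) σ.pt‖ ^ 2)
      ≤ ENNReal.ofReal (potential f fstar η p σ.pair) := by
  have hω : 0 ≤ ωQ := (hQ ⟨0, hn⟩).nonneg
  have hp1' : 0 ≤ 1 - p := by linarith
  have hq : 0 ≤ (1 - p) / p * (ωQ / n) := by positivity
  have hstep := stepsize_quadratic_le hL hη0 hq hη
  have hprob := isProbabilityMeasure_coinLaw hp0.le hp1
  set y := riemExp σ.pt (-(η • σ.avg)) with hy
  set D := objective f y - fstar with hD
  -- The lower bound on the objective keeps the potential nonnegative, so `ENNReal.ofReal` truncates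
  -- nothing.
  have hD0 : 0 ≤ D := sub_nonneg.2 (hfstar y)
  set B := ‖σ.avg - riemGrad (objective f) σ.pt‖ ^ 2 + ωQ / n * (L * η) ^ 2 * ‖σ.avg‖ ^ 2 with hB
  have hB0 : 0 ≤ B := by positivity
  have hfd : ∀ i, MDifferentiable 𝓘(ℝ, E) 𝓘(ℝ, ℝ) (f i) := fun i => (hf i).mdifferentiable
  have htrue : ∀ s : Fin n → S, potential f fstar η p (marinaStep f Q η σ true s).pair = D := by
    intro s
    have h1 : (marinaStep f Q η σ true s).avg
        = riemGrad (E := E) (objective f) (marinaStep f Q η σ true s).pt := by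
      rw [riemGrad_objective hfd]
      simp only [State.avg, marinaStep, if_true]
    have h2 : potential f fstar η p (marinaStep f Q η σ true s).pair
        = D + η / (2 * p) * ‖(marinaStep f Q η σ true s).avg
          - riemGrad (objective f) (marinaStep f Q η σ true s).pt‖ ^ 2 := rfl
    rw [h2, h1, sub_self, norm_zero, zero_pow two_ne_zero, mul_zero, add_zero]
  have hfalse : ∫⁻ s : Fin n → S,
      ENNReal.ofReal (potential f fstar η p (marinaStep f Q η σ false s).pair) ∂(Measure.pi ν)
      ≤ ENNReal.ofReal (D + η / (2 * p) * B) := by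
    have h1 : ∀ s : Fin n → S,
        ENNReal.ofReal (potential f fstar η p (marinaStep f Q η σ false s).pair)
        = ENNReal.ofReal D + ENNReal.ofReal (η / (2 * p)) *
          ENNReal.ofReal (‖(marinaStep f Q η σ false s).avg
            - riemGrad (objective f) (marinaStep f Q η σ false s).pt‖ ^ 2) := by
      intro s
      rw [← ENNReal.ofReal_mul (by positivity), ← ENNReal.ofReal_add hD0 (by positivity)]
      rfl
    simp only [h1]
    rw [lintegral_add_left measurable_const, lintegral_const, measure_univ, mul_one,
      lintegral_const_mul' _ _ ENNReal.ofReal_ne_top, ENNReal.ofReal_add hD0 (by positivity),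
      ENNReal.ofReal_mul (by positivity)]
    gcongr
    exact lintegral_error_compressed_le hM hn hf hQ η σ
  have hint : ∫⁻ r, ENNReal.ofReal (potential f fstar η p (marinaStep f Q η σ r.1 r.2).pair)
        ∂((coinLaw p).prod (Measure.pi ν))
      ≤ ENNReal.ofReal (p * D + (1 - p) * (D + η / (2 * p) * B)) := by
    -- This direction of the Tonelli inequality holds without measurability of the integrand.
    refine (lintegral_prod_le _).trans ?_
    rw [lintegral_coinLaw, ENNReal.ofReal_add (by positivity) (by positivity),
      ENNReal.ofReal_mul hp0.le, ENNReal.ofReal_mul hp1']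
    simp only [htrue, lintegral_const, measure_univ, mul_one]
    gcongr
  refine (add_le_add hint le_rfl).trans ?_
  rw [← ENNReal.ofReal_add (by positivity) (by positivity)]
  refine ENNReal.ofReal_le_ofReal ?_
  have hdesc := objective_step_le hM hn hf η σ.pt σ.avg
  change _ ≤ objective f σ.pt - fstar
    + η / (2 * p) * ‖σ.avg - riemGrad (E := E) (objective f) σ.pt‖ ^ 2
  set a := ‖riemGrad (E := E) (objective f) σ.pt‖ ^ 2 with ha
  set b := ‖σ.avg‖ ^ 2 with hb
  set δ := ‖σ.avg - riemGrad (E := E) (objective f) σ.pt‖ ^ 2 with hδ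
  have hb0 : 0 ≤ b := by positivity
  -- Since (1 - p) η/(2p) = η/(2p) - η/2, the old error loses η/2 · δ, exactly what the descent
  -- inequality adds.
  have h1 : p * D + (1 - p) * (D + η / (2 * p) * B) + η / 2 * a
      = D + η / 2 * a + η / (2 * p) * δ - η / 2 * δ
        + η * b / 2 * ((1 - p) / p * (ωQ / n) * (L * η) ^ 2) := by
    rw [hB]
    field_simp
    ring
  -- The step-size condition, in the form that makes the total coefficient of ‖g‖² at most zero.
  have h2 : η * b / 2 * ((1 - p) / p * (ωQ / n) * (L * η) ^ 2) ≤ η * b / 2 * (1 - L * η) :=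
    mul_le_mul_of_nonneg_left (by linarith) (by positivity)
  rw [h1]
  have h3 : D ≤ objective f σ.pt - η / 2 * (a + b - δ) + L / 2 * η ^ 2 * b - fstar := by
    rw [hD]; linarith
  nlinarith

end OneStep

end

end RMarina

namespace RMarina

noncomputable section

/-! ### Past inputs, fresh inputs and the random output index. -/

section Run

open scoped ENNReal

variable {E : Type*} [NormedAddCommGroup E] [NormedSpace ℝ E] [FiniteDimensional ℝ E]
  {M : Type*} [TopologicalSpace M] [ChartedSpace E M]
  [RiemannianBundle (fun x : M => TangentSpace 𝓘(ℝ, E) x)]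

/-- The state after `k` iterations depends only on the first `k` random inputs. -/
theorem marina_congr {S : Type*} {n : ℕ} (f : Fin n → M → ℝ)
    (Q : Fin n → S → ∀ x : M, TangentSpace 𝓘(ℝ, E) x → TangentSpace 𝓘(ℝ, E) x) (η : ℝ)
    (σ₀ : State E M n) {r r' : ℕ → Bool × (Fin n → S)} {k : ℕ} (h : ∀ j < k, r j = r' j) :
    marina f Q η σ₀ r k = marina f Q η σ₀ r' k := by
  induction k with
  | zero => rfl
  | succ k ih =>
    simp only [marina, ih fun j hj => h j (hj.trans k.lt_succ_self), h k k.lt_succ_self]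

/-- The sequence of inputs with the first `k` terms `z`, and all others equal to `s`. -/
def extendInputs {R : Type*} (k : ℕ) (q : (Finset.range k → R) × R) (j : ℕ) : R :=
  if h : j ∈ Finset.range k then q.1 ⟨j, h⟩ else q.2

theorem measurable_extendInputs {R : Type*} [MeasurableSpace R] (k : ℕ) :
    Measurable (extendInputs (R := R) k) := by
  refine measurable_pi_lambda _ fun j => ?_
  unfold extendInputs
  split_ifs with h
  · exact (measurable_pi_apply _).comp measurable_fst
  · exact measurable_snd

theorem extendInputs_self {R : Type*} (k : ℕ) (q : (Finset.range k → R) × R) :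
    extendInputs k q k = q.2 := by
  simp [extendInputs]

theorem extendInputs_of_lt {R : Type*} {k j : ℕ} (h : j < k) (z : Finset.range k → R) (s s' : R) :
    extendInputs k (z, s) j = extendInputs k (z, s') j := by
  simp [extendInputs, h]

theorem extendInputs_apply {R : Type*} {k j : ℕ} (h : j < k + 1) (r : ℕ → R) :
    extendInputs k (fun i => r i, r k) j = r j := by
  by_cases hj : j < k
  · simp [extendInputs, hj]
  · obtain rfl : j = k := by omega
    simp [extendInputs]

/-- A random input is independent of the past inputs. -/
theorem map_past_prod_eq {R : Type*} [MeasurableSpace R] {Ω : Type*} [MeasurableSpace Ω]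
    {P : Measure Ω} [IsProbabilityMeasure P] {ζ : ℕ → Ω → R} (hζ : ∀ k, Measurable (ζ k))
    (hζindep : iIndepFun ζ P) (k : ℕ) :
    P.map (fun a => ((fun i : Finset.range k => ζ i a), ζ k a))
      = (P.map fun a (i : Finset.range k) => ζ i a).prod (P.map (ζ k)) := by
  have h1 := hζindep.indepFun_finset (Finset.range k) {k} (by simp) hζ
  have h2 : IndepFun (fun a (i : Finset.range k) => ζ i a) (ζ k) P :=
    h1.comp measurable_id (measurable_pi_apply (⟨k, by simp⟩ : ({k} : Finset ℕ)))
  have hpast : Measurable fun a (i : Finset.range k) => ζ i a :=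
    measurable_pi_lambda _ fun i => hζ i
  exact h2.map_prod_eq_prod_map_map hpast.aemeasurable (hζ k).aemeasurable

/-- Expectations of functions of the first `k + 1` inputs, as iterated integrals. -/
theorem lintegral_inputs_eq {R : Type*} [MeasurableSpace R] {Ω : Type*} [MeasurableSpace Ω]
    {P : Measure Ω} [IsProbabilityMeasure P] {ζ : ℕ → Ω → R} (hζ : ∀ k, Measurable (ζ k))
    (hζindep : iIndepFun ζ P) (k : ℕ) {F : (ℕ → R) → ℝ≥0∞} (hF : Measurable F)
    (hFk : ∀ r r', (∀ j < k + 1, r j = r' j) → F r = F r') :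
    ∫⁻ a, F (fun j => ζ j a) ∂P
      = ∫⁻ z, ∫⁻ s, F (extendInputs k (z, s)) ∂(P.map (ζ k))
          ∂(P.map fun a (i : Finset.range k) => ζ i a) := by
  have := (Measure.isProbabilityMeasure_map (μ := P) (hζ k).aemeasurable)
  have hFe : Measurable fun q => F (extendInputs k q) := hF.comp (measurable_extendInputs k)
  have hpast : Measurable fun a (i : Finset.range k) => ζ i a :=
    measurable_pi_lambda _ fun i => hζ i
  rw [← lintegral_prod (fun q => F (extendInputs k q)) hFe.aemeasurable,
    ← map_past_prod_eq hζ hζindep k, lintegral_map hFe (hpast.prodMk (hζ k))]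
  refine lintegral_congr fun a => hFk _ _ fun j hj => ?_
  exact (extendInputs_apply hj fun j => ζ j a).symm

/-- The expectation of a uniformly random term of a sequence, chosen independently. -/
theorem lintegral_uniform_index {Ω : Type*} [MeasurableSpace Ω] {P : Measure Ω}
    {X : Type*} [MeasurableSpace X] {Z : Ω → X} (hZ : Measurable Z) {K : ℕ} {κ : Ω → Fin K}
    (hκ : Measurable κ) (hκunif : ∀ j, P (κ ⁻¹' {j}) = (K : ℝ≥0∞)⁻¹) (hind : IndepFun κ Z P)
    {g : Fin K → X → ℝ≥0∞} (hg : ∀ j, Measurable (g j)) :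
    ∫⁻ a, g (κ a) (Z a) ∂P = (K : ℝ≥0∞)⁻¹ * ∑ j, ∫⁻ a, g j (Z a) ∂P := by
  have hm : ∀ j : Fin K, Measurable (fun i : Fin K => if i = j then (1 : ℝ≥0∞) else 0) := fun j =>
    measurable_of_countable _
  -- Splitting over the values of the index leaves products of an event of `κ` and a function of the
  -- run, which factor by independence.
  have h1 : ∀ a, g (κ a) (Z a) = ∑ j, (if κ a = j then 1 else 0) * g j (Z a) := by
    intro a
    simp
  have h2 : ∀ j, ∫⁻ a, (if κ a = j then 1 else 0) * g j (Z a) ∂P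
      = (K : ℝ≥0∞)⁻¹ * ∫⁻ a, g j (Z a) ∂P := by
    intro j
    refine (lintegral_mul_eq_lintegral_mul_lintegral_of_indepFun'' ((hm j).comp hκ).aemeasurable
      ((hg j).comp hZ).aemeasurable (hind.comp (hm j) (hg j))).trans ?_
    refine congrArg (· * ∫⁻ a, g j (Z a) ∂P) ?_
    rw [← hκunif j, ← lintegral_indicator_one (hκ (measurableSet_singleton j))]
    refine lintegral_congr fun a => ?_
    by_cases h : κ a = j <;> simp [Set.indicator, h]
  have hmul : ∀ j, Measurable fun a => (if κ a = j then (1 : ℝ≥0∞) else 0) * g j (Z a) := fun j =>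
    ((hm j).comp hκ).mul ((hg j).comp hZ)
  simp only [h1]
  rw [lintegral_finsetSum _ fun j _ => hmul j, Finset.mul_sum]
  exact Finset.sum_congr rfl fun j _ => h2 j

theorem measurable_uniform_index {Ω : Type*} [MeasurableSpace Ω] {X : Type*} [MeasurableSpace X]
    {Z : Ω → X} (hZ : Measurable Z) {K : ℕ} {κ : Ω → Fin K} (hκ : Measurable κ)
    {g : Fin K → X → ℝ} (hg : ∀ j, Measurable (g j)) : Measurable fun a => g (κ a) (Z a) :=
  (measurable_from_prod_countable_right (f := fun q : Fin K × X => g q.1 q.2) hg).comp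
    (hκ.prodMk hZ)

/-- If the expectations of nonnegative functions `g 0, …, g (K - 1)` of the run sum up to at most
`B / c`, then a uniformly random one of them has expectation at most `B / (c * K)`. -/
theorem integral_uniform_index_le {Ω : Type*} [MeasurableSpace Ω] {P : Measure Ω}
    {X : Type*} [MeasurableSpace X] {Z : Ω → X} (hZ : Measurable Z) {K : ℕ} (hK : 0 < K)
    {κ : Ω → Fin K} (hκ : Measurable κ) (hκunif : ∀ j, P (κ ⁻¹' {j}) = (K : ℝ≥0∞)⁻¹)
    (hind : IndepFun κ Z P) {g : Fin K → X → ℝ} (hg : ∀ j, Measurable (g j))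
    (hg0 : ∀ j x, 0 ≤ g j x) {c B : ℝ} (hc : 0 < c) (hB : 0 ≤ B)
    (hsum : ∑ j, ∫⁻ a, ENNReal.ofReal (c * g j (Z a)) ∂P ≤ ENNReal.ofReal B) :
    Integrable (fun a => g (κ a) (Z a)) P ∧ ∫ a, g (κ a) (Z a) ∂P ≤ B / (c * K) := by
  have hK' : (0 : ℝ) < K := by exact_mod_cast hK
  have hFm : Measurable fun a => g (κ a) (Z a) := measurable_uniform_index hZ hκ hg
  have hlin : ∫⁻ a, ENNReal.ofReal (g (κ a) (Z a)) ∂P ≤ ENNReal.ofReal (B / (c * K)) := by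
    rw [lintegral_uniform_index hZ hκ hκunif hind
      (g := fun j r => ENNReal.ofReal (g j r)) fun j => ENNReal.measurable_ofReal.comp (hg j)]
    have h1 : ENNReal.ofReal c * ∑ j, ∫⁻ a, ENNReal.ofReal (g j (Z a)) ∂P ≤ ENNReal.ofReal B := by
      refine le_trans (le_of_eq ?_) hsum
      rw [Finset.mul_sum]
      refine Finset.sum_congr rfl fun j _ => ?_
      rw [← lintegral_const_mul' _ _ ENNReal.ofReal_ne_top]
      exact lintegral_congr fun a => (ENNReal.ofReal_mul hc.le).symm
    have h2 : B / (c * K) = (K : ℝ)⁻¹ * (c⁻¹ * B) := by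
      field_simp
    have h3 : ENNReal.ofReal c⁻¹ * ENNReal.ofReal c = 1 := by
      rw [← ENNReal.ofReal_mul (by positivity), inv_mul_cancel₀ hc.ne', ENNReal.ofReal_one]
    rw [h2, ENNReal.ofReal_mul (by positivity), ENNReal.ofReal_mul (by positivity),
      ENNReal.ofReal_inv_of_pos hK', ENNReal.ofReal_natCast]
    refine mul_le_mul_right ?_ _
    calc _ = ENNReal.ofReal c⁻¹ * (ENNReal.ofReal c
            * ∑ j, ∫⁻ a, ENNReal.ofReal (g j (Z a)) ∂P) := by
          rw [← mul_assoc, h3, one_mul]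
      _ ≤ _ := mul_le_mul_right h1 _
  have hnn : 0 ≤ᵐ[P] fun a => g (κ a) (Z a) := Filter.Eventually.of_forall fun a => hg0 _ _
  -- Integrability ensures that the Bochner integral below is not the default value 0.
  refine ⟨(lintegral_ofReal_ne_top_iff_integrable hFm.aestronglyMeasurable hnn).1
      (hlin.trans_lt ENNReal.ofReal_lt_top).ne, ?_⟩
  rw [integral_eq_lintegral_of_nonneg_ae hnn hFm.aestronglyMeasurable]
  exact ENNReal.toReal_le_of_le_ofReal (by positivity) hlin

/-- The squared norm of the gradient. -/
def normGradSq (f : M → ℝ) (x : M) : ℝ := ‖riemGrad (E := E) f x‖ ^ 2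

end Run

end

end RMarina

/-- Measurability is known for the pair in the tangent bundle, so a function of the base point is
read through the projection. -/
theorem RMarina.measurable_normGradSq_pt
    {E : Type*} [NormedAddCommGroup E] [NormedSpace ℝ E] [FiniteDimensional ℝ E]
    {M : Type*} [TopologicalSpace M] [SecondCountableTopology M]
    [ChartedSpace E M] [IsManifold 𝓘(ℝ, E) ∞ M]
    [RiemannianBundle (fun x : M => TangentSpace 𝓘(ℝ, E) x)]
    [IsContMDiffRiemannianBundle 𝓘(ℝ, E) ∞ E (fun x : M => TangentSpace 𝓘(ℝ, E) x)]
    {f : M → ℝ} (hf : MDifferentiable 𝓘(ℝ, E) 𝓘(ℝ, ℝ) f) {n : ℕ} {X : Type*} [MeasurableSpace X]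
    {σ : X → RMarina.State E M n}
    (hσ : @Measurable _ _ _ (borel (TangentBundle 𝓘(ℝ, E) M)) fun r => (σ r).pair) :
    Measurable fun r => RMarina.normGradSq (E := E) f (σ r).pt := by
  have h := (RMarina.measurable_norm_riemGrad_sq hf).comp hσ
  exact h

/-! ### Telescoping over the run and the final bound. -/

open scoped ENNReal in
/-- The expected squared gradient norms along the run are summable against the initial gap. -/
theorem RMarina.sum_lintegral_norm_riemGrad_sq_le
    {E : Type*} [NormedAddCommGroup E] [NormedSpace ℝ E] [FiniteDimensional ℝ E]
    {M : Type*} [TopologicalSpace M] [SecondCountableTopology M]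
    [ChartedSpace E M] [IsManifold 𝓘(ℝ, E) ∞ M]
    [RiemannianBundle (fun x : M => TangentSpace 𝓘(ℝ, E) x)]
    [IsContMDiffRiemannianBundle 𝓘(ℝ, E) ∞ E (fun x : M => TangentSpace 𝓘(ℝ, E) x)]
    (hM : RMarina.GeodesicallyComplete E M)
    {n : ℕ} (hn : 0 < n) (f : Fin n → M → ℝ)
    {L : ℝ} (hL : 0 < L) (hf : ∀ i, RMarina.IsGSmooth E L (f i))
    {fstar : ℝ} (hfstar : ∀ x, fstar ≤ RMarina.objective f x)
    {S : Type*} [MeasurableSpace S] (ν : Fin n → Measure S) [∀ i, IsProbabilityMeasure (ν i)]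
    (Q : Fin n → S → ∀ x : M, TangentSpace 𝓘(ℝ, E) x → TangentSpace 𝓘(ℝ, E) x)
    {ωQ : ℝ} (hQ : ∀ i, RMarina.IsUnbiasedCompressor (ν i) (Q i) ωQ)
    {p : ℝ} (hp0 : 0 < p) (hp1 : p ≤ 1) {η : ℝ} (hη0 : 0 < η)
    (hη : η ≤ 1 / (L * (1 + √((1 - p) / p * (ωQ / n)))))
    (σ₀ : RMarina.State E M n)
    (hσ₀ : σ₀.avg = RMarina.riemGrad (RMarina.objective f) σ₀.pt)
    (hmeas : ∀ k, Measurable[MeasurableSpace.pi, borel (TangentBundle 𝓘(ℝ, E) M)]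
      (fun r : ℕ → Bool × (Fin n → S) => (RMarina.marina f Q η σ₀ r k).pair))
    {Ω : Type*} [MeasurableSpace Ω] (P : Measure Ω) [IsProbabilityMeasure P]
    (ζ : ℕ → Ω → Bool × (Fin n → S)) (hζ : ∀ k, Measurable (ζ k))
    (hζlaw : ∀ k, HasLaw (ζ k) ((RMarina.coinLaw p).prod (Measure.pi ν)) P)
    (hζindep : iIndepFun ζ P) (K : ℕ) :
    ∑ k ∈ Finset.range K, ∫⁻ a, ENNReal.ofReal (η / 2 * RMarina.normGradSq (E := E)
      (RMarina.objective f) (RMarina.marina f Q η σ₀ (fun j => ζ j a) k).pt) ∂P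
      ≤ ENNReal.ofReal (RMarina.objective f σ₀.pt - fstar) := by
  have hfd : MDifferentiable 𝓘(ℝ, E) 𝓘(ℝ, ℝ) (RMarina.objective f) :=
    RMarina.mdifferentiable_objective fun i => (hf i).mdifferentiable
  set Φ : ℕ → (ℕ → Bool × (Fin n → S)) → ℝ≥0∞ := fun k r =>
    ENNReal.ofReal (RMarina.potential f fstar η p (RMarina.marina f Q η σ₀ r k).pair) with hΦ
  set G : ℕ → (ℕ → Bool × (Fin n → S)) → ℝ≥0∞ := fun k r =>
    ENNReal.ofReal (η / 2 * RMarina.normGradSq (E := E) (RMarina.objective f)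
      (RMarina.marina f Q η σ₀ r k).pt) with hG
  have hΦm : ∀ k, Measurable (Φ k) := by
    intro k
    have h : Measurable[borel (TangentBundle 𝓘(ℝ, E) M)]
        (RMarina.potential (E := E) f fstar η p) := by
      borelize (TangentBundle 𝓘(ℝ, E) M)
      exact ((RMarina.measurable_comp_proj hfd.continuous).sub_const fstar).add
        ((RMarina.measurable_norm_sub_riemGrad_sq hfd).const_mul _)
    exact ENNReal.measurable_ofReal.comp (h.comp (hmeas k))
  have hGm : ∀ k, Measurable (G k) := by
    intro k
    exact ENNReal.measurable_ofReal.comp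
      ((RMarina.measurable_normGradSq_pt hfd (hmeas k)).const_mul (η / 2))
  have hcongr : ∀ k r r', (∀ j < k, r j = r' j) →
      RMarina.marina f Q η σ₀ r k = RMarina.marina f Q η σ₀ r' k := fun k r r' h =>
    RMarina.marina_congr f Q η σ₀ h
  have hstep : ∀ k, ∫⁻ a, Φ (k + 1) (fun j => ζ j a) ∂P + ∫⁻ a, G k (fun j => ζ j a) ∂P
      ≤ ∫⁻ a, Φ k (fun j => ζ j a) ∂P := by
    intro k
    have hpr := Measure.isProbabilityMeasure_map (μ := P) (hζ k).aemeasurable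
    have e1 := RMarina.lintegral_inputs_eq hζ hζindep k (hΦm (k + 1))
      (fun r r' h => by simp only [hΦ, hcongr (k + 1) r r' h])
    have e2 := RMarina.lintegral_inputs_eq hζ hζindep k (hΦm k)
      (fun r r' h => by simp only [hΦ, hcongr k r r' fun j hj => h j (hj.trans k.lt_succ_self)])
    have e3 := RMarina.lintegral_inputs_eq hζ hζindep k (hGm k)
      (fun r r' h => by simp only [hG, hcongr k r r' fun j hj => h j (hj.trans k.lt_succ_self)])
    rw [e1, e2, e3, ← lintegral_add_right]
    · refine lintegral_mono fun z => ?_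
      obtain ⟨a₀⟩ : Nonempty Ω := nonempty_of_isProbabilityMeasure P
      -- An arbitrary filler: the state after `k` steps reads only inputs of index below `k`, so
      -- with the past `z` frozen it is one fixed state, and only the fresh input is integrated.
      set s₀ := ζ 0 a₀
      set σ := RMarina.marina f Q η σ₀ (RMarina.extendInputs k (z, s₀)) k with hσ
      have hσs : ∀ s, RMarina.marina f Q η σ₀ (RMarina.extendInputs k (z, s)) k = σ := fun s =>
        hcongr k _ _ fun j hj => RMarina.extendInputs_of_lt hj z s s₀
      simp only [hΦ, hG, RMarina.marina, hσs, RMarina.extendInputs_self, lintegral_const,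
        measure_univ, mul_one]
      rw [(hζlaw k).map_eq]
      exact RMarina.lintegral_potential_step_le hM hn hL hf hfstar hQ hp0 hp1 hη0 hη σ
    · exact ((hGm k).comp (RMarina.measurable_extendInputs k)).lintegral_prod_right'
  have htel : ∀ K, ∑ k ∈ Finset.range K, ∫⁻ a, G k (fun j => ζ j a) ∂P
      + ∫⁻ a, Φ K (fun j => ζ j a) ∂P ≤ ∫⁻ a, Φ 0 (fun j => ζ j a) ∂P := by
    intro K
    induction K with
    | zero => simp
    | succ K ih =>
      rw [Finset.sum_range_succ, add_assoc, add_comm (∫⁻ a, G K _ ∂P)]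
      exact (add_le_add le_rfl (hstep K)).trans ih
  refine (le_self_add.trans (htel K)).trans (le_of_eq ?_)
  -- The initial average estimator equals the gradient, so only the gap of the objective is left in
  -- the potential.
  have h0 : ∀ r, Φ 0 r = ENNReal.ofReal (RMarina.objective f σ₀.pt - fstar) := by
    intro r
    have h1 : RMarina.potential f fstar η p σ₀.pair = RMarina.objective f σ₀.pt - fstar
        + η / (2 * p) * ‖σ₀.avg - RMarina.riemGrad (RMarina.objective f) σ₀.pt‖ ^ 2 := rfl
    rw [hσ₀, sub_self, norm_zero, zero_pow two_ne_zero, mul_zero, add_zero] at h1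
    exact congrArg ENNReal.ofReal h1
  simp only [h0, lintegral_const, measure_univ, mul_one]

theorem theorem5
    {E : Type*} [NormedAddCommGroup E] [NormedSpace ℝ E] [FiniteDimensional ℝ E]
    {M : Type*} [TopologicalSpace M] [T2Space M] [SecondCountableTopology M]
    [ChartedSpace E M] [IsManifold 𝓘(ℝ, E) ∞ M]
    [RiemannianBundle (fun x : M => TangentSpace 𝓘(ℝ, E) x)]
    [IsContMDiffRiemannianBundle 𝓘(ℝ, E) ∞ E (fun x : M => TangentSpace 𝓘(ℝ, E) x)]
    (hM : RMarina.GeodesicallyComplete E M)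
    -- the objective
    {n : ℕ} (hn : 0 < n) (f : Fin n → M → ℝ)
    {L : ℝ} (hL : 0 < L) (hf : ∀ i, RMarina.IsGSmooth E L (f i))
    {fstar : ℝ} (hfstar : ∀ x, fstar ≤ RMarina.objective f x)
    -- the compressors
    {S : Type*} [MeasurableSpace S] (ν : Fin n → Measure S) [∀ i, IsProbabilityMeasure (ν i)]
    (Q : Fin n → S → ∀ x : M, TangentSpace 𝓘(ℝ, E) x → TangentSpace 𝓘(ℝ, E) x)
    {ωQ : ℝ} (hQ : ∀ i, RMarina.IsUnbiasedCompressor (ν i) (Q i) ωQ)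
    -- the parameters
    {p : ℝ} (hp0 : 0 < p) (hp1 : p ≤ 1) {η : ℝ} (hη0 : 0 < η)
    (hη : η ≤ 1 / (L * (1 + √((1 - p) / p * (ωQ / n)))))
    -- the initial state
    (σ₀ : RMarina.State E M n)
    (hσ₀ : σ₀.avg = RMarina.riemGrad (RMarina.objective f) σ₀.pt)
    -- the pairs `(x^k, g^k)` are measurable functions of the random inputs
    (hmeas : ∀ k, Measurable[MeasurableSpace.pi, borel (TangentBundle 𝓘(ℝ, E) M)]
      (fun r : ℕ → Bool × (Fin n → S) =>
        (⟨(RMarina.marina f Q η σ₀ r k).pt, (RMarina.marina f Q η σ₀ r k).avg⟩ :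
          TangentBundle 𝓘(ℝ, E) M)))
    -- the random inputs, independent over the iterations
    {Ω : Type*} [MeasurableSpace Ω] (P : Measure Ω) [IsProbabilityMeasure P]
    (ζ : ℕ → Ω → Bool × (Fin n → S))
    (hζ : ∀ k, Measurable (ζ k))
    (hζlaw : ∀ k, HasLaw (ζ k) ((RMarina.coinLaw p).prod (Measure.pi ν)) P)
    (hζindep : iIndepFun ζ P)
    -- the uniformly random output index, independent of the run
    {K : ℕ} (κ : Ω → Fin K) (hκ : Measurable κ)
    (hκunif : ∀ j, P (κ ⁻¹' {j}) = (K : ENNReal)⁻¹)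
    (hκindep : IndepFun κ (fun a k => ζ k a) P) :
    Integrable (fun a => ‖RMarina.riemGrad (E := E) (RMarina.objective f)
      (RMarina.marina f Q η σ₀ (fun k => ζ k a) (κ a)).pt‖ ^ 2) P ∧
    ∫ a, ‖RMarina.riemGrad (E := E) (RMarina.objective f)
      (RMarina.marina f Q η σ₀ (fun k => ζ k a) (κ a)).pt‖ ^ 2 ∂P
      ≤ 2 * (RMarina.objective f σ₀.pt - fstar) / (η * K) := by
  -- `κ` takes values in `Fin K` on a nonempty space.
  have hK : 0 < K := by
    obtain ⟨a₀⟩ : Nonempty Ω := nonempty_of_isProbabilityMeasure P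
    exact Fin.pos (κ a₀)
  have hfd : MDifferentiable 𝓘(ℝ, E) 𝓘(ℝ, ℝ) (RMarina.objective f) :=
    RMarina.mdifferentiable_objective fun i => (hf i).mdifferentiable
  have hsum := RMarina.sum_lintegral_norm_riemGrad_sq_le hM hn f hL hf hfstar ν Q hQ hp0 hp1 hη0 hη
    σ₀ hσ₀ hmeas P ζ hζ hζlaw hζindep K
  rw [← Fin.sum_univ_eq_sum_range (fun k => ∫⁻ a, ENNReal.ofReal (η / 2 *
    RMarina.normGradSq (E := E) (RMarina.objective f)
      (RMarina.marina f Q η σ₀ (fun j => ζ j a) k).pt) ∂P)] at hsum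
  have hgm : ∀ k, Measurable fun r => RMarina.normGradSq (E := E) (RMarina.objective f)
      (RMarina.marina f Q η σ₀ r k).pt := fun k =>
    RMarina.measurable_normGradSq_pt hfd (hmeas k)
  have hZ : Measurable fun a k => ζ k a := measurable_pi_lambda _ hζ
  have h := RMarina.integral_uniform_index_le hZ hK hκ hκunif hκindep
    (g := fun j r => RMarina.normGradSq (E := E) (RMarina.objective f)
      (RMarina.marina f Q η σ₀ r j).pt)
    (fun j => hgm j)
    (fun _ _ => sq_nonneg _) (half_pos hη0) (sub_nonneg.2 (hfstar σ₀.pt)) hsum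
  have e : 2 * (RMarina.objective f σ₀.pt - fstar) / (η * K)
      = (RMarina.objective f σ₀.pt - fstar) / (η / 2 * K) := by
    field_simp
  rw [e]
  exact h
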